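/- For $\alpha\ge 0$ let $(a_k)_{k\ge1}$ and $(b_k)_{k\ge1}$ be two independent centered stationary Gaussian processes, both with spectral measure $\mu_\alpha=\frac12(\delta_\alpha+\delta_{-\alpha})$, that is, $\mathbb E[a_ka_l]=\mathbb E[b_kb_l]=\int_{\mathbb R}e^{i(k-l)\xi}\,d\mu_\alpha(\xi)=\cos((k-l)\alpha)$ for all $k,l\ge1$. For $n\ge1$ set $$f_n(t)=\frac1{\sqrt n}\sum_{k=1}^n\big(a_k\cos(kt)+b_k\sin(kt)\big),\qquad t\in\mathbb R,$$ and let $\mathcal N(f_n,[0,2\pi])$ be the number of distinct real zeros of $f_n$ in $[0,2\pi]$. Then for every $\ell\in(\sqrt2,2]$ and every $\delta>0$ there is an $\alpha\in[0,\delta)$ such that, for every $\varepsilon>0$, there are infinitely many integers $n\ge1$ for which $\mathcal N(f_n,[0,2\pi])$ is an (a.e.-measurable) random variable with finite expectation and $$\left|\frac{\mathbb E\big[\mathcal N(f_n,[0,2\pi])\big]}{n}-\ell\right|\le\varepsilon .$$ In other words, for arbitrarily small $\alpha$, depending on $\ell$ but not on $\varepsilon$, the number $\ell$ is a limit point of the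 normalized expected number of zeros. -/

import Mathlib

open MeasureTheory ProbabilityTheory
open scoped ENNReal

noncomputable section

namespace RandomTrig

/-- The spectral measure `(δ_α + δ_{-α}) / 2` on the real line. -/
def spectralMeasure (α : ℝ) : Measure ℝ :=
  (2⁻¹ : ℝ≥0∞) • (Measure.dirac α + Measure.dirac (-α))

/-- `(X k)_{k ≥ 1}` is a centered stationary Gaussian process, with spectral measure `μ`, that is,
`𝔼[X k * X l] = ∫ exp (i (k - l) ξ) dμ(ξ)` for all `k, l ≥ 1`. The variable `X 0` is irrelevant. -/
structure IsStationaryGaussian {Ω : Type*} [MeasurableSpace Ω] (P : Measure Ω)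
    (X : ℕ → Ω → ℝ) (μ : Measure ℝ) : Prop where
  isGaussianProcess : IsGaussianProcess (fun k ω ↦ X (k + 1) ω) P
  centered : ∀ k, 1 ≤ k → ∫ ω, X k ω ∂P = 0
  correlation : ∀ k l, 1 ≤ k → 1 ≤ l →
    ((∫ ω, X k ω * X l ω ∂P : ℝ) : ℂ)
      = ∫ ξ, Complex.exp (Complex.I * (((k : ℝ) - (l : ℝ)) * ξ : ℝ)) ∂μ

/-- `(a k)_{k ≥ 1}` and `(b k)_{k ≥ 1}` are two independent centered stationary Gaussian processes,
both with spectral measure `(δ_α + δ_{-α}) / 2`. -/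
structure IsCoefficientPair {Ω : Type*} [MeasurableSpace Ω] (P : Measure Ω)
    (a b : ℕ → Ω → ℝ) (α : ℝ) : Prop where
  left : IsStationaryGaussian P a (spectralMeasure α)
  right : IsStationaryGaussian P b (spectralMeasure α)
  indep : IndepFun (fun ω (k : ℕ) ↦ a (k + 1) ω) (fun ω (k : ℕ) ↦ b (k + 1) ω) P

/-- The random trigonometric polynomial
`f_n(t) = n^{-1/2} ∑_{k=1}^n (a_k cos (k t) + b_k sin (k t))`. -/
def trigPoly {Ω : Type*} (a b : ℕ → Ω → ℝ) (n : ℕ) (ω : Ω) (t : ℝ) : ℝ :=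
  1 / √(n : ℝ) * ∑ k ∈ Finset.Icc 1 n, (a k ω * Real.cos (k * t) + b k ω * Real.sin (k * t))

/-- The number (possibly infinite) of distinct zeros of `f` in the set `s`. -/
def zeroCount (f : ℝ → ℝ) (s : Set ℝ) : ℕ∞ := {t : ℝ | t ∈ s ∧ f t = 0}.encard

/-- The random variable `𝒩(f_n, [0, 2π])`, with values in `[0, ∞]`. -/
def zeros {Ω : Type*} (a b : ℕ → Ω → ℝ) (n : ℕ) (ω : Ω) : ℝ≥0∞ :=
  ((zeroCount (trigPoly a b n ω) (Set.Icc 0 (2 * Real.pi)) : ℕ∞) : ℝ≥0∞)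

/-- The expectation `𝔼[𝒩(f_n, [0, 2π])]`, with values in `[0, ∞]`. -/
def expectedZeros {Ω : Type*} [MeasurableSpace Ω] (P : Measure Ω) (a b : ℕ → Ω → ℝ)
    (n : ℕ) : ℝ≥0∞ := ∫⁻ ω, zeros a b n ω ∂P

end RandomTrig

end

namespace RandomTrig

open Set Filter Topology

/-! The covariance cos((k-l)α) has rank two: if sin α ≠ 0, each coefficient sequence is A cos(kα-τ)
+ B sin(kα-τ) with A, B independent standard Gaussians (`IsStationaryGaussian.exists_map_eq`). For τ
= (n+1)α/2 the mixed sums are odd and vanish, so f_n is, up to a scalar, Re(e^{imt}(U x(t) + V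
y(t))) with m = (n+1)/2, independent complex Gaussians U, V and an explicit plane curve (x, y)
(`sum_trig_eq_re`). A common phase on U and V preserves their law. Averaging over that phase turns
the zero count into the total variation of an argument, and taking expectations gives π E[N] = ∫
√(m² + c(t)²) dt, where c is the angular speed of (x, y) (`lintegral_zeroCount_complexGaussian`).

Up to a similarity the curve is (K(t+α), K(t-α)) with K the centred Dirichlet kernel, so 2c/n is
explicit in the slow time t, the fast phase n(t-α)/2 and nα (`angularSpeed_eq`). If nα tends to β
modulo 2π and sin β ≠ 0, averaging over the fast phase yields E[N]/n → `limitZeros α β`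
(`tendsto_normalizedZeros`). Where sin((t±α)/2) is small there is no uniform bound. Convergence in
L¹ comes instead from comparing masses, as in Scheffé's lemma: the limiting speed makes exactly a
half-turn per phase period (`integral_limitSpeed`), and the argument of the actual curve varies by
at most nπ, because combinations of two translates of K have at most n zeros
(`lintegral_abs_angularSpeed_le`).

The limit is continuous where sin β ≠ 0, tends to 2 as β → 0+, and equals √2 at α = 0, β = π/2. For
small α its value at π/2 is therefore below ℓ, and the intermediate value theorem supplies a
suitable β (`exists_limitZeros_near`). Taking α/(2π) irrational lets nα approach every β, so one α
serves all ε. -/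

/-! ### Measurability of the zero count. -/

theorem natCast_le_zeroCount_iff {f : ℝ → ℝ} {s : Set ℝ} {k : ℕ} :
    (k : ℕ∞) ≤ zeroCount f s ↔
      ∃ τ : Fin k → ℝ, Function.Injective τ ∧ ∀ i, τ i ∈ s ∧ f (τ i) = 0 := by
  constructor
  · intro h
    obtain ⟨t, ht, htk⟩ := Set.exists_subset_encard_eq h
    have hfin : t.Finite := Set.finite_of_encard_eq_coe htk
    have hcard : hfin.toFinset.card = k := by
      rw [hfin.encard_eq_coe_toFinset_card] at htk
      exact_mod_cast htk
    refine ⟨fun i => (hfin.toFinset.equivFinOfCardEq hcard).symm i,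
      Subtype.val_injective.comp (Equiv.injective _), fun i => ?_⟩
    have := ((hfin.toFinset.equivFinOfCardEq hcard).symm i).2
    exact ht (hfin.mem_toFinset.1 this)
  · rintro ⟨τ, hinj, hτ⟩
    have h1 : (Set.range τ).encard = k := by
      rw [← Set.image_univ, hinj.encard_image, Set.encard_univ]
      simp
    rw [← h1]
    exact Set.encard_le_encard (by rintro _ ⟨i, rfl⟩; exact hτ i)

/-- Pairs of a parameter and k zeros with mutual distances at least 1/(j+1) form a closed set.
Projecting along the compact factor keeps it closed, and the union over j is countable. -/
theorem measurableSet_natCast_le_zeroCount {X : Type*} [TopologicalSpace X] [MeasurableSpace X]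
    [BorelSpace X] {f : X → ℝ → ℝ} (hf : Continuous (Function.uncurry f)) (a b : ℝ) (k : ℕ) :
    MeasurableSet {x | (k : ℕ∞) ≤ zeroCount (f x) (Icc a b)} := by
  let C : ℕ → Set (X × (Fin k → Icc a b)) := fun j =>
    {p | ∀ i, f p.1 (p.2 i) = 0 ∧ ∀ i', i ≠ i' → 1 / ((j : ℝ) + 1) ≤ |(p.2 i : ℝ) - p.2 i'|}
  have hC : ∀ j, IsClosed (C j) := by
    intro j
    simp only [C, ofPred_forall, ofPred_and]
    refine isClosed_iInter fun i => IsClosed.inter ?_ (isClosed_iInter fun i' =>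
      isClosed_iInter fun _ => ?_)
    · refine isClosed_eq ?_ continuous_const
      exact hf.comp (by fun_prop : Continuous fun p : X × (Fin k → Icc a b) =>
        (p.1, ((p.2 i : Icc a b) : ℝ)))
    · exact isClosed_le continuous_const (by fun_prop)
  have hEq : {x | (k : ℕ∞) ≤ zeroCount (f x) (Icc a b)} = ⋃ j, Prod.fst '' C j := by
    ext x
    simp only [mem_ofPred_eq, natCast_le_zeroCount_iff, mem_iUnion, mem_image, Prod.exists,
      exists_and_right, exists_eq_right]
    constructor
    · rintro ⟨τ, hinj, hτ⟩
      have hev : ∀ᶠ j : ℕ in atTop, ∀ i i', i ≠ i' → 1 / ((j : ℝ) + 1) ≤ |τ i - τ i'| := by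
        rw [eventually_all]
        intro i
        rw [eventually_all]
        intro i'
        by_cases h : i = i'
        · simp [h]
        · have hpos : 0 < |τ i - τ i'| := abs_pos.2 (sub_ne_zero.2 (hinj.ne h))
          filter_upwards [(tendsto_one_div_add_atTop_nhds_zero_nat (𝕜 := ℝ)).eventually_lt_const
            hpos] with j hj _ using hj.le
      obtain ⟨j, hj⟩ := hev.exists
      exact ⟨j, fun i => ⟨τ i, (hτ i).1⟩, fun i => ⟨(hτ i).2, fun i' h => hj i i' h⟩⟩
    · rintro ⟨j, τ, hτ⟩
      refine ⟨fun i => τ i, fun i i' h => ?_, fun i => ⟨(τ i).2, (hτ i).1⟩⟩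
      by_contra hne
      have h1 := (hτ i).2 i' hne
      simp only at h
      simp only [h, sub_self, abs_zero] at h1
      have : 0 < 1 / ((j : ℝ) + 1) := by positivity
      linarith
  rw [hEq]
  exact MeasurableSet.iUnion fun j => (isClosedMap_fst_of_compactSpace _ (hC j)).measurableSet

/-- The number of zeros in a compact interval depends measurably on the parameter of a
jointly continuous family of functions. -/
theorem measurable_zeroCount {X : Type*} [TopologicalSpace X] [MeasurableSpace X]
    [BorelSpace X] {f : X → ℝ → ℝ} (hf : Continuous (Function.uncurry f)) (a b : ℝ) :
    Measurable fun x => ((zeroCount (f x) (Icc a b) : ℕ∞) : ℝ≥0∞) := by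
  have h : Measurable fun x => zeroCount (f x) (Icc a b) := by
    refine measurable_to_countable' fun v => ?_
    have hk := measurableSet_natCast_le_zeroCount hf a b
    induction v using ENat.recTopCoe with
    | top =>
      have : (fun x => zeroCount (f x) (Icc a b)) ⁻¹' {⊤} =
          ⋂ k : ℕ, {x | (k : ℕ∞) ≤ zeroCount (f x) (Icc a b)} := by
        ext x
        simp [ENat.eq_top_iff_forall_ge]
      rw [this]
      exact MeasurableSet.iInter hk
    | coe k =>
      have : (fun x => zeroCount (f x) (Icc a b)) ⁻¹' {(k : ℕ∞)} =
          {x | (k : ℕ∞) ≤ zeroCount (f x) (Icc a b)} \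
            {x | ((k + 1 : ℕ) : ℕ∞) ≤ zeroCount (f x) (Icc a b)} := by
        ext x
        have hlt : ¬((k + 1 : ℕ) : ℕ∞) ≤ zeroCount (f x) (Icc a b) ↔
            zeroCount (f x) (Icc a b) ≤ k := by
          rw [not_le, Nat.cast_add, Nat.cast_one]
          exact ENat.lt_add_one_iff (ENat.natCast_ne_top k)
        simp only [mem_preimage, mem_singleton_iff, Set.mem_sdiff, mem_ofPred_eq, hlt]
        exact ⟨fun h => ⟨h.ge, h.le⟩, fun h => le_antisymm h.2 h.1⟩
      rw [this]
      exact (hk k).diff (hk (k + 1))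
  exact (Measurable.of_discrete (f := ((↑) : ℕ∞ → ℝ≥0∞))).comp h

/-! ### Banach indicatrix and the averaging formula over rotations. -/

theorem coe_zeroCount_eq_count {f : ℝ → ℝ} (hf : Measurable f) {s : Set ℝ} (hs : MeasurableSet s) :
    ((zeroCount f s : ℕ∞) : ℝ≥0∞) = Measure.count (s ∩ f ⁻¹' {0}) := by
  rw [Measure.count_apply (hs.inter (hf (measurableSet_singleton 0)))]
  rfl

/-- The Banach indicatrix formula for a continuously differentiable function. -/
theorem lintegral_zeroCount_sub {Φ Φ' : ℝ → ℝ} (h : ∀ t, HasDerivAt Φ (Φ' t) t)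
    (hc : Continuous Φ') (a b : ℝ) :
    ∫⁻ y, ((zeroCount (fun t => Φ t - y) (Icc a b) : ℕ∞) : ℝ≥0∞)
      = ∫⁻ t in Icc a b, ENNReal.ofReal |Φ' t| := by
  have hΦ : Continuous Φ := continuous_iff_continuousAt.2 fun t => (h t).continuousAt
  set S : Set ℝ := Icc a b ∩ {t | Φ' t ≠ 0} with hS
  set Z : Set ℝ := Icc a b ∩ {t | Φ' t = 0} with hZ
  have hSm : MeasurableSet S := measurableSet_Icc.inter
    (hc.measurable (measurableSet_singleton 0)).compl
  have hZm : MeasurableSet Z := measurableSet_Icc.inter (hc.measurable (measurableSet_singleton 0))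
  have hSZ : Icc a b = S ∪ Z := by
    ext t; simp only [hS, hZ, mem_union, mem_inter_iff, mem_ofPred_eq]; tauto
  have hdisj : Disjoint S Z := by
    rw [Set.disjoint_left]; rintro t ⟨_, h1⟩ ⟨_, h2⟩; exact h1 h2
  let r : (ℝ →L[ℝ] ℝ) → NNReal := fun A => if A 1 = 0 then 1 else ‖A 1‖₊ / 2
  obtain ⟨T, A, hTd, hTm, hTs, hTa, hTn⟩ :=
    exists_partition_approximatesLinearOn_of_hasFDerivWithinAt Φ S
      (fun t => ContinuousLinearMap.toSpanSingleton ℝ (Φ' t))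
      (fun t _ => (h t).hasFDerivAt.hasFDerivWithinAt) r (by
        intro A
        simp only [r]
        split_ifs with hA
        · exact one_ne_zero
        · simpa using hA)
  have hinj : ∀ n, InjOn Φ (S ∩ T n) := by
    intro n x hx y hy hxy
    obtain ⟨z, hz, hzA⟩ := hTn ⟨x, hx.1⟩ n
    have hA1 : A n 1 = Φ' z := by rw [hzA]; simp
    have hne : A n 1 ≠ 0 := by rw [hA1]; exact hz.2
    have hlip := hTa n x hx y hy
    have hAxy : A n (x - y) = A n 1 * (x - y) := by
      have := (A n).map_smul (x - y) 1
      simp only [smul_eq_mul, mul_one] at this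
      rw [this]; ring
    rw [hxy, sub_self, zero_sub, norm_neg, hAxy, norm_mul] at hlip
    simp only [r, if_neg hne, NNReal.coe_div, coe_nnnorm, NNReal.coe_ofNat] at hlip
    have h1 : 0 < ‖A n 1‖ := norm_pos_iff.2 hne
    have h2 : ‖x - y‖ ≤ 0 := by
      by_contra h3
      push Not at h3
      nlinarith [mul_pos h1 h3]
    exact sub_eq_zero.1 (norm_le_zero_iff.1 h2)
  have hSU : S = ⋃ n, S ∩ T n := by
    rw [← inter_iUnion, inter_eq_left.2 hTs]
  have hEd : Pairwise (Function.onFun Disjoint fun n => S ∩ T n) := fun i j hij =>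
    (hTd hij).mono inter_subset_right inter_subset_right
  have hEm : ∀ n, MeasurableSet (S ∩ T n) := fun n => hSm.inter (hTm n)
  -- One-dimensional Sard: the critical values are negligible, so only the injective pieces
  -- contribute to the count.
  have hnull : volume (Φ '' Z) = 0 := by
    refine addHaar_image_eq_zero_of_det_fderivWithin_eq_zero volume
      (f' := fun t => ContinuousLinearMap.toSpanSingleton ℝ (Φ' t))
      (fun t _ => (h t).hasFDerivAt.hasFDerivWithinAt) fun t ht => ?_
    have : Φ' t = 0 := ht.2
    simp [this]
  have himg : ∀ n, MeasurableSet (Φ '' (S ∩ T n)) := fun n =>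
    (hEm n).image_of_continuousOn_injOn hΦ.continuousOn (hinj n)
  have hae : (fun y => ((zeroCount (fun t => Φ t - y) (Icc a b) : ℕ∞) : ℝ≥0∞)) =ᵐ[volume]
      fun y => ∑' n, (Φ '' (S ∩ T n)).indicator 1 y := by
    filter_upwards [measure_eq_zero_iff_ae_notMem.1 hnull] with y hy
    have hfib : Icc a b ∩ (fun t => Φ t - y) ⁻¹' {0} = ⋃ n, (S ∩ T n) ∩ Φ ⁻¹' {y} := by
      rw [← iUnion_inter, ← hSU, hSZ]
      ext t
      simp only [mem_inter_iff, mem_union, mem_preimage, mem_singleton_iff, sub_eq_zero]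
      constructor
      · rintro ⟨h1 | h1, h2⟩
        · exact ⟨h1, h2⟩
        · exact absurd ⟨t, h1, h2⟩ hy
      · rintro ⟨h1, h2⟩
        exact ⟨Or.inl h1, h2⟩
    rw [coe_zeroCount_eq_count (by fun_prop) measurableSet_Icc, hfib, measure_iUnion]
    · refine tsum_congr fun n => ?_
      by_cases hyn : y ∈ Φ '' (S ∩ T n)
      · obtain ⟨t, ht, rfl⟩ := hyn
        have : (S ∩ T n) ∩ Φ ⁻¹' {Φ t} = {t} := by
          ext u
          simp only [mem_inter_iff, mem_preimage, mem_singleton_iff]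
          exact ⟨fun hu => hinj n hu.1 ht hu.2, fun hu => by subst hu; exact ⟨ht, rfl⟩⟩
        rw [this, indicator_of_mem (mem_image_of_mem _ ht)]
        simp
      · have : (S ∩ T n) ∩ Φ ⁻¹' {y} = ∅ := by
          ext u
          simp only [mem_inter_iff, mem_preimage, mem_singleton_iff, mem_empty_iff_false, iff_false,
            not_and]
          exact fun hu he => hyn ⟨u, hu, he⟩
        rw [this, indicator_of_notMem hyn]
        simp
    · exact fun i j hij => (hEd hij).mono inter_subset_left inter_subset_left
    · exact fun n => (hEm n).inter (hΦ.measurable (measurableSet_singleton y))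
  rw [lintegral_congr_ae hae,
    lintegral_tsum fun n => (measurable_one.indicator (himg n)).aemeasurable]
  have hterm : ∀ n, ∫⁻ y, (Φ '' (S ∩ T n)).indicator 1 y =
      ∫⁻ t in S ∩ T n, ENNReal.ofReal |Φ' t| := by
    intro n
    rw [lintegral_indicator (himg n),
      lintegral_image_eq_lintegral_abs_deriv_mul (hEm n)
        (fun t _ => (h t).hasDerivWithinAt) (hinj n)]
    simp
  simp_rw [hterm]
  rw [← lintegral_iUnion hEm hEd, ← hSU, hSZ, lintegral_union hZm hdisj]
  have : ∫⁻ t in Z, ENNReal.ofReal |Φ' t| = 0 := by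
    rw [setLIntegral_congr_fun hZm (g := fun _ => 0)]
    · simp
    · intro t ht
      have : Φ' t = 0 := ht.2
      simp [this]
  rw [this, add_zero]

/-- A nonvanishing continuously differentiable planar curve has a continuously differentiable
logarithm. -/
theorem exists_exp_eq_of_hasDerivAt {w w' : ℝ → ℂ} (h : ∀ t, HasDerivAt w (w' t) t)
    (hc : Continuous w') (h0 : ∀ t, w t ≠ 0) :
    ∃ L : ℝ → ℂ, (∀ t, HasDerivAt L (w' t / w t) t) ∧ ∀ t, w t = Complex.exp (L t) := by
  have hw : Continuous w := continuous_iff_continuousAt.2 fun t => (h t).continuousAt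
  have hq : Continuous fun t => w' t / w t := hc.div hw h0
  let L : ℝ → ℂ := fun t => Complex.log (w 0) + ∫ u in (0 : ℝ)..t, w' u / w u
  have hL : ∀ t, HasDerivAt L (w' t / w t) t := fun t =>
    (intervalIntegral.integral_hasDerivAt_right (hq.intervalIntegrable _ _)
      (hq.stronglyMeasurableAtFilter _ _) hq.continuousAt).const_add _
  refine ⟨L, hL, fun t => ?_⟩
  have hd : ∀ t, HasDerivAt (fun t => w t * Complex.exp (-L t)) 0 t := by
    intro t
    convert! (h t).mul (hL t).neg.cexp using 1
    have := h0 t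
    field_simp
    ring
  have hconst : w t * Complex.exp (-L t) = w 0 * Complex.exp (-L 0) :=
    is_const_of_deriv_eq_zero (fun t => (hd t).differentiableAt) (fun t => (hd t).deriv) t 0
  have hL0 : Complex.exp (-L 0) = (w 0)⁻¹ := by
    simp [L, Complex.exp_neg, Complex.exp_log (h0 0)]
  rw [hL0, mul_inv_cancel₀ (h0 0), Complex.exp_neg] at hconst
  exact eq_of_mul_inv_eq_one hconst

/-- Averaging over rotations the number of intersections of a planar curve with a line gives the
total variation of the argument of the curve. -/
theorem lintegral_zeroCount_rotate {w w' : ℝ → ℂ} (h : ∀ t, HasDerivAt w (w' t) t)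
    (hc : Continuous w') (h0 : ∀ t, w t ≠ 0) (a b : ℝ) :
    ∫⁻ η in Ioc 0 Real.pi,
        ((zeroCount (fun t => (Complex.exp (η * Complex.I) * w t).re) (Icc a b) : ℕ∞) : ℝ≥0∞)
      = ∫⁻ t in Icc a b, ENNReal.ofReal |(w' t / w t).im| := by
  obtain ⟨L, hL, hwL⟩ := exists_exp_eq_of_hasDerivAt h hc h0
  have hw : Continuous w := continuous_iff_continuousAt.2 fun t => (h t).continuousAt
  set Φ : ℝ → ℝ := fun t => (L t).im with hΦdef
  have hΦ' : ∀ t, HasDerivAt Φ ((w' t / w t).im) t := fun t =>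
    Complex.imCLM.hasFDerivAt.comp_hasDerivAt t (hL t)
  have hΦ : Continuous Φ := continuous_iff_continuousAt.2 fun t => (hΦ' t).continuousAt
  rw [← lintegral_zeroCount_sub hΦ' (Complex.continuous_im.comp (hc.div hw h0)) a b]
  set c : ℝ → ℝ≥0∞ := fun y => ((zeroCount (fun t => Φ t - y) (Icc a b) : ℕ∞) : ℝ≥0∞) with hcdef
  have hcm : Measurable c := measurable_zeroCount (by fun_prop) a b
  -- With w = e^L, the real part of e^{iη} w vanishes exactly when η + Im L is an odd multiple of
  -- π/2.
  have hcount : ∀ η : ℝ,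
      ((zeroCount (fun t => (Complex.exp (η * Complex.I) * w t).re) (Icc a b) : ℕ∞) : ℝ≥0∞)
        = ∑' k : ℤ, c (Real.pi / 2 + k * Real.pi - η) := by
    intro η
    rw [coe_zeroCount_eq_count (by fun_prop) measurableSet_Icc]
    simp_rw [hcdef]
    have hrw : ∀ y, ((zeroCount (fun t => Φ t - y) (Icc a b) : ℕ∞) : ℝ≥0∞)
        = Measure.count (Icc a b ∩ (fun t => Φ t - y) ⁻¹' {0}) := fun y =>
      coe_zeroCount_eq_count (by fun_prop) measurableSet_Icc
    simp_rw [hrw]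
    rw [← measure_iUnion]
    · congr 1
      ext t
      simp only [mem_inter_iff, mem_preimage, mem_singleton_iff, mem_iUnion, exists_and_left]
      refine and_congr_right fun _ => ?_
      rw [hwL t, ← Complex.exp_add, Complex.exp_re]
      have hsimp : ((η : ℂ) * Complex.I + L t).im = η + Φ t := by simp [hΦdef]
      rw [hsimp, mul_eq_zero, Real.cos_eq_zero_iff]
      simp only [Real.exp_ne_zero, false_or]
      refine exists_congr fun k => ?_
      constructor <;> intro hk <;> linarith
    · intro i j hij
      rw [Function.onFun, Set.disjoint_left]
      rintro t ⟨_, h1⟩ ⟨_, h2⟩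
      simp only [mem_preimage, mem_singleton_iff] at h1 h2
      have h3 : ((i : ℝ) - j) * Real.pi = 0 := by linarith
      rcases mul_eq_zero.1 h3 with h4 | h4
      · exact hij (by exact_mod_cast sub_eq_zero.1 h4)
      · exact Real.pi_ne_zero h4
    · intro k
      exact measurableSet_Icc.inter ((by fun_prop : Measurable fun t =>
        Φ t - (Real.pi / 2 + k * Real.pi - η)) (measurableSet_singleton 0))
  simp_rw [hcount]
  have hcomp : ∀ k : ℤ, Measurable fun η : ℝ => c (Real.pi / 2 + k * Real.pi - η) := fun k =>
    hcm.comp (by fun_prop)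
  rw [lintegral_tsum fun k => (hcomp k).aemeasurable]
  have hflip : ∫⁻ y, c y = ∫⁻ y, c (Real.pi / 2 - y) :=
    (lintegral_sub_left_eq_self c (Real.pi / 2)).symm
  -- The translates of (0, π] by multiples of π tile the line, so the sum over k and the integral
  -- over η unfold to one integral over all levels.
  have htile := (isAddFundamentalDomain_Ioc Real.pi_pos 0).lintegral_eq_tsum'
    (fun y => c (Real.pi / 2 - y))
  rw [zero_add] at htile
  let e : ℤ ≃ AddSubgroup.zmultiples Real.pi := Equiv.ofInjective (fun n : ℤ => n • Real.pi)
    (zsmul_left_strictMono Real.pi_pos).injective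
  rw [hflip, htile, ← e.tsum_eq]
  refine tsum_congr fun k => lintegral_congr fun η => ?_
  congr 1
  change _ = Real.pi / 2 - (-(k • Real.pi) + η)
  rw [zsmul_eq_mul]
  ring

/-! ### Complex Gaussian variables and their rotation invariance. -/

/-- The standard Gaussian measure on the complex plane, with independent standard real and
imaginary parts. -/
noncomputable def complexGaussian : Measure ℂ :=
  ((gaussianReal 0 1).prod (gaussianReal 0 1)).map Complex.equivRealProdCLM.symm

instance : IsGaussian complexGaussian := by unfold complexGaussian; infer_instance

theorem map_rotation_gaussianReal (θ : ℝ) :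
    ((gaussianReal 0 1).prod (gaussianReal 0 1)).map (ContinuousLinearMap.rotation θ)
      = (gaussianReal 0 1).prod (gaussianReal 0 1) :=
  IsGaussian.map_rotation_eq_self (by simp) θ

theorem lintegral_complexGaussian {f : ℂ → ℝ≥0∞} (hf : Measurable f) :
    ∫⁻ z, f z ∂complexGaussian =
      ∫⁻ x, ∫⁻ y, f (x + y * Complex.I) ∂gaussianReal 0 1 ∂gaussianReal 0 1 := by
  have hm : Measurable (Complex.equivRealProdCLM.symm : ℝ × ℝ → ℂ) :=
    (Complex.equivRealProdCLM.symm.continuous).measurable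
  rw [complexGaussian, lintegral_map hf hm,
    lintegral_prod (fun p => f (Complex.equivRealProdCLM.symm p)) (hf.comp hm).aemeasurable]
  simp only [Complex.equivRealProdCLM_symm_apply]

theorem integral_complexGaussian : ∫ z, z ∂complexGaussian = 0 := by
  have hm : Measurable (Complex.equivRealProdCLM.symm : ℝ × ℝ → ℂ) :=
    (Complex.equivRealProdCLM.symm.continuous).measurable
  rw [complexGaussian, integral_map hm.aemeasurable (by fun_prop)]
  have h1 : ∫ p : ℝ × ℝ, p ∂((gaussianReal 0 1).prod (gaussianReal 0 1)) = 0 := by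
    have hi : Integrable (fun p : ℝ × ℝ => p) ((gaussianReal 0 1).prod (gaussianReal 0 1)) :=
      IsGaussian.integrable_fun_id
    refine Prod.ext ?_ ?_
    · rw [fst_integral hi, integral_fun_fst (fun x : ℝ => x)]
      simp
    · rw [snd_integral hi, integral_fun_snd (fun x : ℝ => x)]
      simp
  have := Complex.equivRealProdCLM.symm.toContinuousLinearMap.integral_comp_comm
    (IsGaussian.integrable_fun_id (μ := (gaussianReal 0 1).prod (gaussianReal 0 1)))
  simp only [h1, ContinuousLinearEquiv.coe_coe, map_zero] at this
  exact this

theorem map_rotation_complexGaussian (θ : ℝ) :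
    (complexGaussian.prod complexGaussian).map (ContinuousLinearMap.rotation θ)
      = complexGaussian.prod complexGaussian :=
  IsGaussian.map_rotation_eq_self integral_complexGaussian θ

theorem map_exp_mul_complexGaussian (θ : ℝ) :
    complexGaussian.map (fun z => Complex.exp (θ * Complex.I) * z) = complexGaussian := by
  have hm : Measurable (Complex.equivRealProdCLM.symm : ℝ × ℝ → ℂ) :=
    (Complex.equivRealProdCLM.symm.continuous).measurable
  conv_rhs => rw [complexGaussian, ← map_rotation_gaussianReal (-θ)]
  rw [complexGaussian, Measure.map_map (by fun_prop) hm, Measure.map_map hm (by fun_prop)]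
  congr 1
  ext p
  simp only [Function.comp_apply, ContinuousLinearMap.rotation_apply,
    Complex.equivRealProdCLM_symm_apply, Complex.exp_mul_I]
  apply Complex.ext <;> simp [Complex.cos_ofReal_re, Complex.sin_ofReal_re,
    Complex.cos_ofReal_im, Complex.sin_ofReal_im] <;> ring

theorem lintegral_exp_mul_complexGaussian {f : ℂ → ℝ≥0∞} (hf : Measurable f) (θ : ℝ) :
    ∫⁻ z, f (Complex.exp (θ * Complex.I) * z) ∂complexGaussian = ∫⁻ z, f z ∂complexGaussian := by
  conv_rhs => rw [← map_exp_mul_complexGaussian θ, lintegral_map hf (by fun_prop)]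

/-- A rotation of the plane turns the linear form into √(m² + c²) times the first coordinate and
preserves the Gaussian law. -/
theorem lintegral_prod_gaussianReal_abs (m c : ℝ) :
    ∫⁻ r, ∫⁻ x, ENNReal.ofReal |m * r + c * x| ∂gaussianReal 0 1 ∂gaussianReal 0 1 =
      ENNReal.ofReal √(m ^ 2 + c ^ 2) * ∫⁻ x, ENNReal.ofReal |x| ∂gaussianReal 0 1 := by
  set ρ := √(m ^ 2 + c ^ 2) with hρ
  obtain ⟨θ, hm, hc⟩ : ∃ θ : ℝ, m = ρ * Real.cos θ ∧ c = ρ * Real.sin θ := by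
    refine ⟨Complex.arg ⟨m, c⟩, ?_, ?_⟩
    · have := Complex.norm_mul_cos_arg ⟨m, c⟩
      rw [Complex.norm_eq_sqrt_sq_add_sq] at this
      exact this.symm
    · have := Complex.norm_mul_sin_arg ⟨m, c⟩
      rw [Complex.norm_eq_sqrt_sq_add_sq] at this
      exact this.symm
  have hρ0 : 0 ≤ ρ := Real.sqrt_nonneg _
  calc ∫⁻ r, ∫⁻ x, ENNReal.ofReal |m * r + c * x| ∂gaussianReal 0 1 ∂gaussianReal 0 1
      = ∫⁻ p, ENNReal.ofReal |m * p.1 + c * p.2|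
          ∂((gaussianReal 0 1).prod (gaussianReal 0 1)) :=
        (lintegral_prod (fun p : ℝ × ℝ => ENNReal.ofReal |m * p.1 + c * p.2|)
          (by fun_prop)).symm
    _ = ∫⁻ p, ENNReal.ofReal ρ * ENNReal.ofReal |(ContinuousLinearMap.rotation θ p).1|
          ∂((gaussianReal 0 1).prod (gaussianReal 0 1)) := by
        refine lintegral_congr fun p => ?_
        rw [← ENNReal.ofReal_mul hρ0, ContinuousLinearMap.rotation_apply]
        congr 1
        have h1 : m * p.1 + c * p.2 = ρ * (Real.cos θ * p.1 + Real.sin θ * p.2) := by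
          rw [mul_add, ← mul_assoc, ← mul_assoc, ← hm, ← hc]
        rw [h1, abs_mul, abs_of_nonneg hρ0]
        rfl
    _ = ENNReal.ofReal ρ * ∫⁻ p, ENNReal.ofReal |p.1|
          ∂((gaussianReal 0 1).prod (gaussianReal 0 1)) := by
        rw [lintegral_const_mul _ (by fun_prop)]
        congr 1
        conv_rhs => rw [← map_rotation_gaussianReal θ]
        rw [lintegral_map (by fun_prop) (by fun_prop)]
    _ = _ := by
        rw [lintegral_prod _ (by fun_prop)]
        simp

theorem lintegral_Ioi_gaussianReal {f : ℝ → ℝ≥0∞} (hf : Measurable f) (heven : ∀ x, f (-x) = f x) :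
    2 * ∫⁻ x in Ioi 0, f x ∂gaussianReal 0 1 = ∫⁻ x, f x ∂gaussianReal 0 1 := by
  have hneg : (gaussianReal 0 1).map (fun x => -x) = gaussianReal 0 1 := by
    simpa using gaussianReal_map_neg (μ := 0) (v := 1)
  have h1 : ∫⁻ x in Iio 0, f x ∂gaussianReal 0 1 = ∫⁻ x in Ioi 0, f x ∂gaussianReal 0 1 := by
    conv_lhs => rw [← hneg]
    rw [setLIntegral_map measurableSet_Iio hf measurable_neg]
    simp [heven]
  have : NullSingletonClass (gaussianReal 0 1) := nullSingletonClass_gaussianReal one_ne_zero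
  rw [← lintegral_add_compl f measurableSet_Ioi (μ := gaussianReal 0 1) (A := Ioi 0), compl_Ioi,
    setLIntegral_congr Iio_ae_eq_Iic.symm, h1, two_mul]

/-- Integration of a radial function against the planar standard Gaussian measure. -/
theorem exists_lintegral_radial_gaussianReal : ∃ C : ℝ≥0∞, ∀ K : ℝ → ℝ≥0∞, Measurable K →
    ∫⁻ x, ∫⁻ y, K (√(x ^ 2 + y ^ 2)) ∂gaussianReal 0 1 ∂gaussianReal 0 1 =
      C * ∫⁻ r in Ioi 0, ENNReal.ofReal r * K r ∂gaussianReal 0 1 := by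
  refine ⟨ENNReal.ofReal (2 * Real.pi) * ENNReal.ofReal (√(2 * Real.pi))⁻¹, fun K hK => ?_⟩
  have hg : gaussianReal 0 1 = volume.withDensity (gaussianPDF 0 1) :=
    gaussianReal_of_var_ne_zero 0 one_ne_zero
  have hKm : Measurable fun p : ℝ × ℝ => K (√(p.1 ^ 2 + p.2 ^ 2)) := hK.comp (by fun_prop)
  have hφ : Measurable (gaussianPDF 0 1) := measurable_gaussianPDF 0 1
  rw [← lintegral_prod (fun p : ℝ × ℝ => K (√(p.1 ^ 2 + p.2 ^ 2))) hKm.aemeasurable, hg,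
    prod_withDensity hφ hφ, ← Measure.volume_eq_prod,
    lintegral_withDensity_eq_lintegral_mul _ (by fun_prop) hKm, ← lintegral_comp_polarCoord_symm]
  have hr : ∀ p ∈ polarCoord.target, ENNReal.ofReal p.1 •
      ((fun z : ℝ × ℝ => gaussianPDF 0 1 z.1 * gaussianPDF 0 1 z.2) *
        fun p : ℝ × ℝ => K (√(p.1 ^ 2 + p.2 ^ 2))) (polarCoord.symm p) =
      ENNReal.ofReal (√(2 * Real.pi))⁻¹ * (gaussianPDF 0 1 p.1 * (ENNReal.ofReal p.1 * K p.1)) := by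
    rintro ⟨r, θ⟩ hp
    have hr0 : 0 < r := by simpa using hp.1
    have h1 : (r * Real.cos θ) ^ 2 + (r * Real.sin θ) ^ 2 = r ^ 2 := by
      linear_combination r ^ 2 * Real.sin_sq_add_cos_sq θ
    have h2 : gaussianPDF 0 1 (r * Real.cos θ) * gaussianPDF 0 1 (r * Real.sin θ) =
        ENNReal.ofReal (√(2 * Real.pi))⁻¹ * gaussianPDF 0 1 r := by
      simp only [gaussianPDF]
      rw [← ENNReal.ofReal_mul (gaussianPDFReal_nonneg _ _ _), ← ENNReal.ofReal_mul (by positivity)]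
      congr 1
      simp only [gaussianPDFReal, sub_zero, NNReal.coe_one, mul_one]
      rw [mul_mul_mul_comm, ← Real.exp_add, ← h1]
      ring_nf
    simp only [Pi.mul_apply, polarCoord_symm_apply, smul_eq_mul, h1, h2, Real.sqrt_sq hr0.le]
    ring
  rw [setLIntegral_congr_fun polarCoord.open_target.measurableSet hr, polarCoord_target,
    Measure.volume_eq_prod, ← Measure.prod_restrict, lintegral_prod _ (by fun_prop)]
  simp only [lintegral_const, MeasurableSet.univ, Measure.restrict_apply, univ_inter,
    Real.volume_Ioo]
  rw [setLIntegral_withDensity_eq_setLIntegral_mul _ hφ (by fun_prop) measurableSet_Ioi,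
    lintegral_mul_const _ (by fun_prop), lintegral_const_mul _ (by fun_prop)]
  simp only [Pi.mul_apply]
  rw [show Real.pi - -Real.pi = 2 * Real.pi by ring]
  ring

/-- If `U` and `V` are independent standard complex Gaussian variables, then
`𝔼 |m + c * Im (V / U)| = √(m ^ 2 + c ^ 2)`. -/
theorem lintegral_complexGaussian_abs (m c : ℝ) :
    ∫⁻ z, ENNReal.ofReal |m + c * (z.2 / z.1).im| ∂(complexGaussian.prod complexGaussian) =
      ENNReal.ofReal √(m ^ 2 + c ^ 2) := by
  obtain ⟨C, hC⟩ := exists_lintegral_radial_gaussianReal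
  have key : ∀ m c : ℝ,
      2 * ∫⁻ z, ENNReal.ofReal |m + c * (z.2 / z.1).im| ∂(complexGaussian.prod complexGaussian) =
      ENNReal.ofReal √(m ^ 2 + c ^ 2) * (C * ∫⁻ x, ENNReal.ofReal |x| ∂gaussianReal 0 1) := by
    intro m c
    -- Rotating v by the argument of u makes the denominator real, so only |u| remains.
    have hrot : ∀ u : ℂ, ∫⁻ v, ENNReal.ofReal |m + c * (v / u).im| ∂complexGaussian =
        ∫⁻ x, ENNReal.ofReal |m + c * (x / ‖u‖)| ∂gaussianReal 0 1 := by
      intro u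
      rw [← lintegral_exp_mul_complexGaussian (by fun_prop) u.arg,
        lintegral_complexGaussian (by fun_prop)]
      have : ∀ v : ℂ, (Complex.exp (u.arg * Complex.I) * v / u).im = v.im / ‖u‖ := by
        intro v
        have h1 : Complex.exp (u.arg * Complex.I) * v / u = v / (‖u‖ : ℂ) := by
          have h2 := mul_div_mul_left v (‖u‖ : ℂ) (Complex.exp_ne_zero (u.arg * Complex.I))
          rwa [mul_comm _ (‖u‖ : ℂ), Complex.norm_mul_exp_arg_mul_I u] at h2
        rw [h1, Complex.div_ofReal_im]
      simp [this]
    have hK : Measurable fun r : ℝ =>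
        ∫⁻ x, ENNReal.ofReal |m + c * (x / r)| ∂gaussianReal 0 1 :=
      Measurable.lintegral_prod_right' (f := fun p : ℝ × ℝ => ENNReal.ofReal |m + c * (p.2 / p.1)|)
        (by fun_prop)
    rw [lintegral_prod _ (by fun_prop)]
    simp_rw [hrot]
    rw [lintegral_complexGaussian (f := fun u =>
      ∫⁻ x, ENNReal.ofReal |m + c * (x / ‖u‖)| ∂gaussianReal 0 1)
      (hK.comp measurable_norm)]
    have hn : ∀ x y : ℝ, ‖(x : ℂ) + y * Complex.I‖ = √(x ^ 2 + y ^ 2) := fun x y =>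
      Complex.norm_add_mul_I x y
    simp_rw [hn]
    rw [hC _ hK]
    -- The Jacobian r of polar coordinates cancels the division by r and leaves a linear form in two
    -- Gaussians.
    have hin : ∀ r ∈ Ioi (0 : ℝ),
        ENNReal.ofReal r * ∫⁻ x, ENNReal.ofReal |m + c * (x / r)| ∂gaussianReal 0 1 =
        ∫⁻ x, ENNReal.ofReal |m * r + c * x| ∂gaussianReal 0 1 := by
      intro r hr
      have hr0 : (0 : ℝ) < r := hr
      rw [← lintegral_const_mul _ (by fun_prop)]
      refine lintegral_congr fun x => ?_
      rw [← ENNReal.ofReal_mul hr0.le]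
      congr 1
      rw [← abs_of_pos hr0, ← abs_mul, abs_of_pos hr0]
      congr 1
      field_simp
    rw [setLIntegral_congr_fun measurableSet_Ioi hin, mul_left_comm,
      lintegral_Ioi_gaussianReal, lintegral_prod_gaussianReal_abs]
    · ring
    · exact Measurable.lintegral_prod_right'
        (f := fun p : ℝ × ℝ => ENNReal.ofReal |m * p.1 + c * p.2|) (by fun_prop)
    · intro r
      conv_rhs => rw [← show (gaussianReal 0 1).map (fun x => -x) = gaussianReal 0 1 by
        simpa using gaussianReal_map_neg (μ := 0) (v := 1)]
      rw [lintegral_map (by fun_prop) measurable_neg]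
      refine lintegral_congr fun x => ?_
      rw [← abs_neg]
      ring_nf
  -- The case m = 1, c = 0 has left side 2, which fixes the product of constants without computing
  -- it.
  have hone := key 1 0
  simp only [zero_mul, add_zero, abs_one, ENNReal.ofReal_one, lintegral_const, measure_univ,
    mul_one, one_pow, ne_eq, OfNat.ofNat_ne_zero, not_false_eq_true, zero_pow, Real.sqrt_one,
    one_mul] at hone
  have := key m c
  rw [← hone, mul_comm] at this
  exact (ENNReal.mul_left_inj (by simp) (by simp)).1 this

theorem ae_complexGaussian_ne_zero : ∀ᵐ u ∂complexGaussian, u.im ≠ 0 := by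
  have hms : MeasurableSet {u : ℂ | u.im = 0} :=
    Complex.measurable_im (measurableSet_singleton 0)
  rw [ae_iff]
  simp only [ne_eq, not_not]
  have : NullSingletonClass (gaussianReal 0 1) := nullSingletonClass_gaussianReal one_ne_zero
  rw [← lintegral_indicator_one hms,
    lintegral_complexGaussian (measurable_one.indicator hms)]
  have : ∀ x y : ℝ, indicator {u : ℂ | u.im = 0} (1 : ℂ → ℝ≥0∞) (x + y * Complex.I) =
      indicator {0} 1 y := by
    intro x y
    simp [indicator]
  simp_rw [this]
  rw [lintegral_indicator_one (measurableSet_singleton 0)]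
  simp

theorem ae_prod_complexGaussian :
    ∀ᵐ z ∂(complexGaussian.prod complexGaussian), (z.2 / z.1).im ≠ 0 := by
  have hms : MeasurableSet {z : ℂ × ℂ | (z.2 / z.1).im ≠ 0} :=
    ((by fun_prop : Measurable fun z : ℂ × ℂ => (z.2 / z.1).im) (measurableSet_singleton 0)).compl
  rw [Measure.ae_prod_iff_ae_ae hms]
  filter_upwards [ae_complexGaussian_ne_zero] with u hu
  have hu0 : u ≠ 0 := by rintro rfl; simp at hu
  have h1 : ∀ᵐ v ∂(complexGaussian.map fun z => Complex.exp ((-u.arg : ℝ) * Complex.I) * z),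
      v.im ≠ 0 := by
    rw [map_exp_mul_complexGaussian]; exact ae_complexGaussian_ne_zero
  filter_upwards [ae_of_ae_map (by fun_prop) h1] with v hv
  have h2 : v / u = Complex.exp ((-u.arg : ℝ) * Complex.I) * v / (‖u‖ : ℂ) := by
    conv_lhs => rw [← Complex.norm_mul_exp_arg_mul_I u]
    have hu' : (‖u‖ : ℂ) ≠ 0 := by simpa using hu0
    rw [Complex.ofReal_neg, neg_mul, Complex.exp_neg]
    field_simp
  change (v / u).im ≠ 0
  rw [h2, Complex.div_ofReal_im]
  exact div_ne_zero hv (norm_ne_zero_iff.2 hu0)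

/-- If v/u is not real, u and v are linearly independent over ℝ. Hence almost every random curve
avoids the origin and has a continuous argument. -/
theorem ne_zero_of_im_div_ne_zero {u v : ℂ} (h : (v / u).im ≠ 0) {x y : ℝ}
    (hxy : x ^ 2 + y ^ 2 ≠ 0) : u * x + v * y ≠ 0 := by
  intro h0
  have hu : u ≠ 0 := by rintro rfl; simp at h
  have h1 : (x : ℂ) + v / u * y = 0 := by
    field_simp
    linear_combination h0
  have h2 := congrArg Complex.im h1
  have h3 := congrArg Complex.re h1
  simp only [Complex.add_im, Complex.ofReal_im, Complex.im_mul_ofReal, zero_add,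
    Complex.zero_im, mul_eq_zero, h, false_or] at h2
  subst h2
  simp at h3
  simp [h3] at hxy

/-! ### The Kac-Rice formula. -/

/-- The Kac-Rice formula for the curve `(x, y)` carried by a rotating frame of speed `m`, with
standard Gaussian coefficients. -/
theorem lintegral_zeroCount_complexGaussian {x y x' y' : ℝ → ℝ}
    (hx : ∀ t, HasDerivAt x (x' t) t) (hy : ∀ t, HasDerivAt y (y' t) t)
    (hx' : Continuous x') (hy' : Continuous y') (h0 : ∀ t, x t ^ 2 + y t ^ 2 ≠ 0) (m a b : ℝ) :
    ENNReal.ofReal Real.pi * ∫⁻ z, ((zeroCount (fun t => (Complex.exp ((m * t : ℝ) * Complex.I) *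
        (z.1 * x t + z.2 * y t)).re) (Icc a b) : ℕ∞) : ℝ≥0∞)
          ∂(complexGaussian.prod complexGaussian) =
      ∫⁻ t in Icc a b, ENNReal.ofReal
        √(m ^ 2 + ((x t * y' t - x' t * y t) / (x t ^ 2 + y t ^ 2)) ^ 2) := by
  have hxc : Continuous x := continuous_iff_continuousAt.2 fun t => (hx t).continuousAt
  have hyc : Continuous y := continuous_iff_continuousAt.2 fun t => (hy t).continuousAt
  let w : ℂ × ℂ → ℝ → ℂ := fun z t =>
    Complex.exp ((m * t : ℝ) * Complex.I) * (z.1 * x t + z.2 * y t)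
  let w' : ℂ × ℂ → ℝ → ℂ := fun z t =>
    Complex.exp ((m * t : ℝ) * Complex.I) * (m * Complex.I) * (z.1 * x t + z.2 * y t) +
      Complex.exp ((m * t : ℝ) * Complex.I) * (z.1 * x' t + z.2 * y' t)
  have hw : ∀ z t, HasDerivAt (w z) (w' z t) t := by
    intro z t
    have h1 : HasDerivAt (fun t : ℝ => ((m * t : ℝ) : ℂ) * Complex.I) (m * Complex.I) t := by
      have := ((hasDerivAt_id t).const_mul m).ofReal_comp.mul_const Complex.I
      simpa using this
    exact h1.cexp.mul (((hx t).ofReal_comp.const_mul z.1).add ((hy t).ofReal_comp.const_mul z.2))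
  have hw' : ∀ z, Continuous (w' z) := fun z => by fun_prop
  set N : ℂ × ℂ → ℝ≥0∞ := fun z => ((zeroCount (fun t => (w z t).re) (Icc a b) : ℕ∞) : ℝ≥0∞)
    with hN
  have hNm : Measurable fun p : (ℂ × ℂ) × ℝ => ((zeroCount
      (fun t => (Complex.exp (p.2 * Complex.I) * w p.1 t).re) (Icc a b) : ℕ∞) : ℝ≥0∞) :=
    measurable_zeroCount (f := fun (p : (ℂ × ℂ) × ℝ) t =>
      (Complex.exp (p.2 * Complex.I) * w p.1 t).re) (by fun_prop) a b
  have hNm' : Measurable N :=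
    measurable_zeroCount (f := fun (z : ℂ × ℂ) t => (w z t).re) (by fun_prop) a b
  have hinv : ∀ η : ℝ, ∫⁻ z, ((zeroCount
      (fun t => (Complex.exp (η * Complex.I) * w z t).re) (Icc a b) : ℕ∞) : ℝ≥0∞)
        ∂(complexGaussian.prod complexGaussian) =
      ∫⁻ z, N z ∂(complexGaussian.prod complexGaussian) := by
    intro η
    have hmap : (complexGaussian.prod complexGaussian).map
        (Prod.map (fun z => Complex.exp (η * Complex.I) * z)
          (fun z => Complex.exp (η * Complex.I) * z)) = complexGaussian.prod complexGaussian := by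
      rw [← Measure.map_prod_map _ _ (by fun_prop) (by fun_prop), map_exp_mul_complexGaussian]
    conv_rhs => rw [← hmap, lintegral_map hNm' (by fun_prop)]
    refine lintegral_congr fun z => ?_
    simp only [hN, w, Prod.map]
    congr 3
    ext t
    congr 1
    ring
  have hconst : ENNReal.ofReal Real.pi * ∫⁻ z, N z ∂(complexGaussian.prod complexGaussian) =
      ∫⁻ η in Ioc 0 Real.pi, ∫⁻ z, ((zeroCount
        (fun t => (Complex.exp ((η : ℝ) * Complex.I) * w z t).re) (Icc a b) : ℕ∞) : ℝ≥0∞)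
        ∂(complexGaussian.prod complexGaussian) := by
    simp_rw [hinv]
    rw [lintegral_const]
    simp [mul_comm]
  change ENNReal.ofReal Real.pi * ∫⁻ z, N z ∂(complexGaussian.prod complexGaussian) = _
  rw [hconst, lintegral_lintegral_swap
    (f := fun (η : ℝ) (z : ℂ × ℂ) => ((zeroCount
        (fun t => (Complex.exp ((η : ℝ) * Complex.I) * w z t).re) (Icc a b) : ℕ∞) : ℝ≥0∞))
    (hNm.comp measurable_swap).aemeasurable]
  have hcrofton : ∀ᵐ z ∂(complexGaussian.prod complexGaussian),
      ∫⁻ η in Ioc 0 Real.pi, ((zeroCount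
        (fun t => (Complex.exp ((η : ℝ) * Complex.I) * w z t).re) (Icc a b) : ℕ∞) : ℝ≥0∞) =
      ∫⁻ t in Icc a b, ENNReal.ofReal |(w' z t / w z t).im| := by
    filter_upwards [ae_prod_complexGaussian] with z hz
    exact lintegral_zeroCount_rotate (hw z) (hw' z) (fun t => mul_ne_zero (Complex.exp_ne_zero _)
      (ne_zero_of_im_div_ne_zero hz (h0 t))) a b
  rw [lintegral_congr_ae hcrofton, lintegral_lintegral_swap]
  · refine lintegral_congr fun t => ?_
    rw [← lintegral_complexGaussian_abs]
    set ρ := √(x t ^ 2 + y t ^ 2) with hρ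
    have hρ2 : ρ ^ 2 = x t ^ 2 + y t ^ 2 := Real.sq_sqrt (by positivity)
    have hρ0 : ρ ≠ 0 := by
      intro h; rw [h] at hρ2; exact h0 t (by rw [← hρ2]; ring)
    -- Rotating the pair of Gaussians by the polar angle of (x, y) at the fixed time t reduces the
    -- curve to ρU there; the rotated pair (U, V) has the same law.
    obtain ⟨θ, hxt, hyt⟩ : ∃ θ : ℝ, x t = ρ * Real.cos θ ∧ y t = ρ * Real.sin θ := by
      refine ⟨Complex.arg ⟨x t, y t⟩, ?_, ?_⟩
      · have := Complex.norm_mul_cos_arg ⟨x t, y t⟩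
        rw [Complex.norm_eq_sqrt_sq_add_sq] at this
        exact this.symm
      · have := Complex.norm_mul_sin_arg ⟨x t, y t⟩
        rw [Complex.norm_eq_sqrt_sq_add_sq] at this
        exact this.symm
    rw [← map_rotation_complexGaussian θ]
    conv_rhs => rw [lintegral_map (by fun_prop) (by fun_prop)]
    rw [map_rotation_complexGaussian θ]
    have hae : ∀ᵐ z ∂(complexGaussian.prod complexGaussian),
        (ContinuousLinearMap.rotation θ z).1 ≠ 0 := by
      have h1 : ∀ᵐ z ∂((complexGaussian.prod complexGaussian).map
          (ContinuousLinearMap.rotation θ)), (z.2 / z.1).im ≠ 0 := by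
        rw [map_rotation_complexGaussian]; exact ae_prod_complexGaussian
      filter_upwards [ae_of_ae_map (by fun_prop) h1] with z hz hz0
      rw [hz0] at hz
      simp at hz
    refine lintegral_congr_ae ?_
    filter_upwards [hae] with z hz
    set U := (ContinuousLinearMap.rotation θ z).1 with hU
    set V := (ContinuousLinearMap.rotation θ z).2 with hV
    have hU' : U = Real.cos θ * z.1 + Real.sin θ * z.2 := by
      simp [hU, ContinuousLinearMap.rotation_apply]
    have hV' : V = -Real.sin θ * z.1 + Real.cos θ * z.2 := by
      simp [hV, ContinuousLinearMap.rotation_apply]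
    have hcs : ((Real.cos θ : ℝ) : ℂ) ^ 2 + ((Real.sin θ : ℝ) : ℂ) ^ 2 = 1 := by
      exact_mod_cast Real.cos_sq_add_sin_sq θ
    have hz1 : z.1 = Real.cos θ * U - Real.sin θ * V := by
      rw [hU', hV']; linear_combination (-z.1) * hcs
    have hz2 : z.2 = Real.sin θ * U + Real.cos θ * V := by
      rw [hU', hV']; linear_combination (-z.2) * hcs
    have hden : z.1 * x t + z.2 * y t = ρ * U := by
      rw [hxt, hyt, hz1, hz2, Complex.ofReal_mul, Complex.ofReal_mul]
      linear_combination (ρ * U) * hcs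
    -- The middle term is the real radial growth rate; it drops out of the imaginary part and leaves
    -- m + c Im(V/U).
    have hquot : w' z t / w z t = m * Complex.I +
        (((x' t * Real.cos θ + y' t * Real.sin θ) / ρ : ℝ) : ℂ) +
        (((x t * y' t - x' t * y t) / (x t ^ 2 + y t ^ 2) : ℝ) : ℂ) * (V / U) := by
      have hρc : (ρ : ℂ) ≠ 0 := by exact_mod_cast hρ0
      have hE := Complex.exp_ne_zero (((m * t : ℝ) : ℂ) * Complex.I)
      simp only [w, w', hden]
      rw [← hρ2, hxt, hyt, hz1, hz2]
      push_cast
      field_simp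
      ring
    rw [hquot]
    congr 2
    simp only [Complex.add_im, Complex.ofReal_im, Complex.mul_im,
      Complex.ofReal_re, Complex.I_im, Complex.I_re]
    ring
  · exact Measurable.aemeasurable (by unfold Function.uncurry; fun_prop)

/-! ### The coefficient processes have rank two. -/

section Coefficients

variable {Ω : Type*} [MeasurableSpace Ω] {P : Measure Ω}

theorem integral_exp_spectralMeasure (α x : ℝ) :
    ∫ ξ, Complex.exp (Complex.I * ((x * ξ : ℝ) : ℂ)) ∂spectralMeasure α = Real.cos (x * α) := by
  have h1 : ∀ c : ℝ, Integrable (fun ξ : ℝ => Complex.exp (Complex.I * ((x * ξ : ℝ) : ℂ)))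
      (Measure.dirac c) := fun c => integrable_dirac (by simp)
  rw [spectralMeasure, integral_smul_measure, integral_add_measure (h1 _) (h1 _), integral_dirac,
    integral_dirac, Complex.ofReal_cos, Complex.cos]
  simp only [ENNReal.toReal_inv, ENNReal.toReal_ofNat, Complex.real_smul]
  push_cast
  ring_nf

theorem IsStationaryGaussian.integral_mul {X : ℕ → Ω → ℝ} {α : ℝ}
    (h : IsStationaryGaussian P X (spectralMeasure α)) {k l : ℕ} (hk : 1 ≤ k) (hl : 1 ≤ l) :
    ∫ ω, X k ω * X l ω ∂P = Real.cos (((k : ℝ) - l) * α) := by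
  have := h.correlation k l hk hl
  rw [integral_exp_spectralMeasure] at this
  exact_mod_cast this

theorem IsStationaryGaussian.memLp {X : ℕ → Ω → ℝ} {μ : Measure ℝ}
    (h : IsStationaryGaussian P X μ) {k : ℕ} (hk : 1 ≤ k) : MemLp (X k) 2 P := by
  obtain ⟨k, rfl⟩ := Nat.exists_eq_add_of_le' hk
  exact (h.1.hasGaussianLaw_eval k).memLp_two

/-- The difference of the two sides has second moment zero, since cos((k-l)α) is the Gram matrix of
the unit plane vectors at angles kα, which satisfy the same linear relation. -/
theorem IsStationaryGaussian.ae_eq {X : ℕ → Ω → ℝ} {α : ℝ}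
    (h : IsStationaryGaussian P X (spectralMeasure α)) {k : ℕ} (hk : 1 ≤ k) :
    ∀ᵐ ω ∂P, X k ω * Real.sin α =
      Real.sin ((2 - k) * α) * X 1 ω + Real.sin ((k - 1) * α) * X 2 ω := by
  have h1 := h.memLp le_rfl
  have h2 := h.memLp one_le_two
  have hk' := h.memLp hk
  set p := Real.sin ((2 - k) * α)
  set q := Real.sin ((k - 1) * α)
  set s := Real.sin α
  set Y : Ω → ℝ := fun ω => X k ω * s - (p * X 1 ω + q * X 2 ω) with hY
  have hYm : MemLp Y 2 P := (hk'.mul_const s).sub ((h1.const_mul p).add (h2.const_mul q))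
  have hint : ∫ ω, Y ω ^ 2 ∂P = 0 := by
    have hexp : ∀ ω, Y ω ^ 2 = s ^ 2 * (X k ω * X k ω) + p ^ 2 * (X 1 ω * X 1 ω) +
        q ^ 2 * (X 2 ω * X 2 ω) - 2 * s * p * (X k ω * X 1 ω) - 2 * s * q * (X k ω * X 2 ω) +
        2 * p * q * (X 1 ω * X 2 ω) := by
      intro ω; simp only [hY]; ring
    simp_rw [hexp]
    have ikk : Integrable (fun ω => X k ω * X k ω) P := hk'.integrable_mul hk'
    have i11 : Integrable (fun ω => X 1 ω * X 1 ω) P := h1.integrable_mul h1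
    have i22 : Integrable (fun ω => X 2 ω * X 2 ω) P := h2.integrable_mul h2
    have ik1 : Integrable (fun ω => X k ω * X 1 ω) P := hk'.integrable_mul h1
    have ik2 : Integrable (fun ω => X k ω * X 2 ω) P := hk'.integrable_mul h2
    have i12 : Integrable (fun ω => X 1 ω * X 2 ω) P := h1.integrable_mul h2
    rw [integral_add (by fun_prop) (by fun_prop), integral_sub (by fun_prop) (by fun_prop),
      integral_sub (by fun_prop) (by fun_prop), integral_add (by fun_prop) (by fun_prop),
      integral_add (by fun_prop) (by fun_prop)]
    simp only [integral_const_mul]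
    rw [h.integral_mul hk hk, h.integral_mul le_rfl le_rfl, h.integral_mul one_le_two one_le_two,
      h.integral_mul hk le_rfl, h.integral_mul hk one_le_two, h.integral_mul le_rfl one_le_two]
    simp only [sub_self, zero_mul, Real.cos_zero, Nat.cast_one, Nat.cast_ofNat, p, q, s]
    have e1 : (2 - (k : ℝ)) * α = α - (k - 1) * α := by ring
    have e2 : ((k : ℝ) - 2) * α = (k - 1) * α - α := by ring
    have e3 : ((1 : ℝ) - 2) * α = -α := by ring
    rw [e1, e2, e3, Real.cos_neg, Real.sin_sub, Real.cos_sub]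
    set x := ((k : ℝ) - 1) * α
    have hx := Real.sin_sq_add_cos_sq x
    have hα := Real.sin_sq_add_cos_sq α
    linear_combination (-Real.sin α ^ 2) * hx - Real.sin x ^ 2 * hα
  have hzero := (integral_eq_zero_iff_of_nonneg (fun ω => sq_nonneg (Y ω)) hYm.integrable_sq).1 hint
  filter_upwards [hzero] with ω hω
  have : Y ω = 0 := by simpa using hω
  simp only [hY] at this
  linarith

/-- `X 1` and `X 2` determine the process; changing basis gives two uncorrelated, hence independent,
Gaussians. They are written as a measurable function φ of the whole sequence so that the
independence of the two processes passes to them. The phase τ is left free so that the frequencies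
can be centred later. -/
theorem IsStationaryGaussian.exists_map_eq [IsProbabilityMeasure P] {X : ℕ → Ω → ℝ} {α : ℝ}
    (h : IsStationaryGaussian P X (spectralMeasure α)) (hα : Real.sin α ≠ 0) (τ : ℝ) :
    ∃ φ : (ℕ → ℝ) → ℝ × ℝ, Measurable φ ∧
      AEMeasurable (fun ω => φ fun k => X (k + 1) ω) P ∧
      P.map (fun ω => φ fun k => X (k + 1) ω) = (gaussianReal 0 1).prod (gaussianReal 0 1) ∧
      ∀ k : ℕ, 1 ≤ k → ∀ᵐ ω ∂P, X k ω =
        (φ fun k => X (k + 1) ω).1 * Real.cos (k * α - τ) +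
        (φ fun k => X (k + 1) ω).2 * Real.sin (k * α - τ) := by
  set s := Real.sin α
  -- Inverse of the 2×2 system expressing `X 1` and `X 2` through the new pair; its determinant is
  -- sin α.
  set p := Real.sin (2 * α - τ) / s with hp
  set q := -Real.sin (α - τ) / s with hq
  set p' := -Real.cos (2 * α - τ) / s with hp'
  set q' := Real.cos (α - τ) / s with hq'
  let T : ℝ × ℝ →L[ℝ] ℝ × ℝ :=
    (p • ContinuousLinearMap.fst ℝ ℝ ℝ + q • ContinuousLinearMap.snd ℝ ℝ ℝ).prod
      (p' • ContinuousLinearMap.fst ℝ ℝ ℝ + q' • ContinuousLinearMap.snd ℝ ℝ ℝ)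
  have hT : ∀ v, T v = (p * v.1 + q * v.2, p' * v.1 + q' * v.2) := fun v => rfl
  have h1 := h.memLp le_rfl
  have h2 := h.memLp one_le_two
  have hG : HasGaussianLaw (fun ω => T (X 1 ω, X 2 ω)) P :=
    (h.1.hasGaussianLaw_prodMk (s := 0) (t := 1)).map_fun T
  have hcross : ∀ c d c' d' : ℝ, ∫ ω, (c * X 1 ω + d * X 2 ω) * (c' * X 1 ω + d' * X 2 ω) ∂P =
      c * c' + d * d' + (c * d' + d * c') * Real.cos α := by
    intro c d c' d'
    have hexp : ∀ ω, (c * X 1 ω + d * X 2 ω) * (c' * X 1 ω + d' * X 2 ω) =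
        c * c' * (X 1 ω * X 1 ω) + d * d' * (X 2 ω * X 2 ω) +
          (c * d' + d * c') * (X 1 ω * X 2 ω) := fun ω => by ring
    simp_rw [hexp]
    have i11 : Integrable (fun ω => X 1 ω * X 1 ω) P := h1.integrable_mul h1
    have i22 : Integrable (fun ω => X 2 ω * X 2 ω) P := h2.integrable_mul h2
    have i12 : Integrable (fun ω => X 1 ω * X 2 ω) P := h1.integrable_mul h2
    rw [integral_add (by fun_prop) (by fun_prop), integral_add (by fun_prop) (by fun_prop)]
    simp only [integral_const_mul]
    rw [h.integral_mul le_rfl le_rfl, h.integral_mul one_le_two one_le_two,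
      h.integral_mul le_rfl one_le_two]
    have e3 : ((1 : ℝ) - 2) * α = -α := by ring
    simp only [sub_self, zero_mul, Real.cos_zero, Nat.cast_one, Nat.cast_ofNat, e3, Real.cos_neg,
      mul_one]
  have hmean : ∀ c d : ℝ, ∫ ω, (c * X 1 ω + d * X 2 ω) ∂P = 0 := by
    intro c d
    rw [integral_add ((h1.integrable one_le_two).const_mul _)
      ((h2.integrable one_le_two).const_mul _), integral_const_mul, integral_const_mul,
      h.centered 1 le_rfl, h.centered 2 one_le_two]
    simp
  have hs2 : s ^ 2 = 1 - Real.cos α ^ 2 := by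
    have := Real.sin_sq_add_cos_sq α; simp only [s]; linarith
  have e2 : 2 * α - τ = (α - τ) + α := by ring
  have hu := Real.sin_sq_add_cos_sq (α - τ)
  have hpq : p * p + q * q + (p * q + q * p) * Real.cos α = 1 := by
    rw [hp, hq, e2, Real.sin_add]
    field_simp
    linear_combination s ^ 2 * hu - Real.sin (α - τ) ^ 2 * hs2
  have hpq' : p' * p' + q' * q' + (p' * q' + q' * p') * Real.cos α = 1 := by
    rw [hp', hq', e2, Real.cos_add]
    field_simp
    linear_combination s ^ 2 * hu - Real.cos (α - τ) ^ 2 * hs2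
  have hpp : p * p' + q * q' + (p * q' + q * p') * Real.cos α = 0 := by
    rw [hp, hq, hp', hq', e2, Real.cos_add, Real.sin_add]
    field_simp
    linear_combination Real.sin (α - τ) * Real.cos (α - τ) * hs2
  have hA : P.map (fun ω => p * X 1 ω + q * X 2 ω) = gaussianReal 0 1 := by
    have hL : HasGaussianLaw (fun ω => p * X 1 ω + q * X 2 ω) P := hG.fst
    rw [hL.map_eq_gaussianReal, hmean, variance_of_integral_eq_zero hL.aemeasurable (hmean p q)]
    simp_rw [pow_two, hcross, hpq]
    simp
  have hB : P.map (fun ω => p' * X 1 ω + q' * X 2 ω) = gaussianReal 0 1 := by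
    have hL : HasGaussianLaw (fun ω => p' * X 1 ω + q' * X 2 ω) P := hG.snd
    rw [hL.map_eq_gaussianReal, hmean, variance_of_integral_eq_zero hL.aemeasurable (hmean p' q')]
    simp_rw [pow_two, hcross, hpq']
    simp
  have hind : IndepFun (fun ω => p * X 1 ω + q * X 2 ω) (fun ω => p' * X 1 ω + q' * X 2 ω) P := by
    refine HasGaussianLaw.indepFun_of_covariance_eq_zero hG ?_
    change cov[(fun ω => p * X 1 ω) + fun ω => q * X 2 ω,
      (fun ω => p' * X 1 ω) + fun ω => q' * X 2 ω; P] = 0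
    rw [covariance_eq_sub ((h1.const_mul p).add (h2.const_mul q))
      ((h1.const_mul p').add (h2.const_mul q'))]
    simp only [Pi.mul_apply, Pi.add_apply, hcross, hpp, hmean, mul_zero, sub_zero]
  refine ⟨fun x => T (x 0, x 1), by fun_prop, hG.aemeasurable, ?_, fun k hk => ?_⟩
  · have := (indepFun_iff_map_prod_eq_prod_map_map hG.fst.aemeasurable hG.snd.aemeasurable).1 hind
    exact this.trans (congrArg₂ Measure.prod hA hB)
  · filter_upwards [h.ae_eq hk] with ω hω
    simp only [hT, zero_add, one_add_one_eq_two]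
    have c1 : Real.sin ((2 - k) * α) = Real.sin (2 * α - τ) * Real.cos (k * α - τ) -
        Real.cos (2 * α - τ) * Real.sin (k * α - τ) := by
      rw [← Real.sin_sub]; ring_nf
    have c2 : Real.sin ((k - 1) * α) = Real.sin (k * α - τ) * Real.cos (α - τ) -
        Real.cos (k * α - τ) * Real.sin (α - τ) := by
      rw [← Real.sin_sub]; ring_nf
    refine mul_right_cancel₀ hα (hω.trans ?_)
    rw [c1, c2, hp, hq, hp', hq']
    field_simp
    ring

end Coefficients

/-- If (A, B) comes from the first process and (C, D) from the second, the complex variables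
required by `sum_trig_eq_re` are A - iC and D + iB, which mix the two processes. Only a permutation
and a sign change are involved. -/
theorem map_rearrange_gaussianReal :
    (((gaussianReal 0 1).prod (gaussianReal 0 1)).prod
      ((gaussianReal 0 1).prod (gaussianReal 0 1))).map
        (fun p : (ℝ × ℝ) × ℝ × ℝ =>
          ((p.1.1 - p.2.1 * Complex.I : ℂ), (p.2.2 + p.1.2 * Complex.I : ℂ))) =
      complexGaussian.prod complexGaussian := by
  refine Measure.ext_of_lintegral _ fun f hf => ?_
  have hneg : (gaussianReal 0 1).map (fun x => -x) = gaussianReal 0 1 := by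
    simpa using gaussianReal_map_neg (μ := 0) (v := 1)
  rw [lintegral_map hf (by fun_prop), lintegral_prod _ (by fun_prop),
    lintegral_prod _ (by fun_prop), lintegral_prod _ (by fun_prop),
    lintegral_complexGaussian (by fun_prop)]
  refine lintegral_congr fun x => ?_
  have h1 : ∀ y : ℝ, ∫⁻ p : ℝ × ℝ, f ((x - p.1 * Complex.I : ℂ), (p.2 + y * Complex.I : ℂ))
      ∂((gaussianReal 0 1).prod (gaussianReal 0 1)) =
      ∫⁻ z, ∫⁻ w, f ((x + z * Complex.I : ℂ), (w + y * Complex.I : ℂ))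
        ∂(gaussianReal 0 1) ∂(gaussianReal 0 1) := by
    intro y
    rw [lintegral_prod _ (by fun_prop)]
    conv_rhs => rw [← hneg, lintegral_map (by fun_prop) (by fun_prop), hneg]
    simp [sub_eq_add_neg]
  simp_rw [h1]
  rw [lintegral_lintegral_swap (by fun_prop)]
  refine lintegral_congr fun z => ?_
  rw [lintegral_lintegral_swap (by fun_prop), lintegral_complexGaussian (by fun_prop)]

/-! ### Reduction of f_n to a planar curve. -/

/-- The first coordinate of the planar curve behind the covariance of `f_n`. -/
noncomputable def curveX (α : ℝ) (n : ℕ) (t : ℝ) : ℝ :=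
  ∑ k ∈ Finset.Icc 1 n, Real.cos (((k : ℝ) - (n + 1) / 2) * α) *
    Real.cos (((k : ℝ) - (n + 1) / 2) * t)

/-- The second coordinate of the planar curve behind the covariance of `f_n`. -/
noncomputable def curveY (α : ℝ) (n : ℕ) (t : ℝ) : ℝ :=
  ∑ k ∈ Finset.Icc 1 n, Real.sin (((k : ℝ) - (n + 1) / 2) * α) *
    Real.sin (((k : ℝ) - (n + 1) / 2) * t)

/-- A sum of values of an odd function at symmetric points vanishes. -/
theorem sum_Icc_odd_eq_zero (n : ℕ) {f : ℝ → ℝ} (hf : ∀ x, f (-x) = -f x) :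
    ∑ k ∈ Finset.Icc 1 n, f ((k : ℝ) - (n + 1) / 2) = 0 := by
  have h : ∑ k ∈ Finset.Icc 1 n, f ((k : ℝ) - (n + 1) / 2) =
      ∑ k ∈ Finset.Icc 1 n, -f ((k : ℝ) - (n + 1) / 2) := by
    refine Finset.sum_nbij' (fun k => n + 1 - k) (fun k => n + 1 - k) ?_ ?_ ?_ ?_ ?_
    · intro k hk; simp only [Finset.mem_Icc] at hk ⊢; omega
    · intro k hk; simp only [Finset.mem_Icc] at hk ⊢; omega
    · intro k hk; simp only [Finset.mem_Icc] at hk; omega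
    · intro k hk; simp only [Finset.mem_Icc] at hk; omega
    · intro k hk
      simp only [Finset.mem_Icc] at hk
      rw [← hf, Nat.cast_sub (by omega)]
      congr 1
      push_cast
      ring
  rw [Finset.sum_neg_distrib] at h
  linarith

/-- Writing kt = (k-m)t + mt with m = (n+1)/2 extracts the rotation e^{imt}. The frequencies k-m are
symmetric about zero, so the mixed sine-cosine sums cancel. -/
theorem sum_trig_eq_re (α : ℝ) (n : ℕ) (t A B C D : ℝ) :
    ∑ k ∈ Finset.Icc 1 n,
      ((A * Real.cos (k * α - (n + 1) / 2 * α) + B * Real.sin (k * α - (n + 1) / 2 * α)) *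
          Real.cos (k * t) +
        (C * Real.cos (k * α - (n + 1) / 2 * α) + D * Real.sin (k * α - (n + 1) / 2 * α)) *
          Real.sin (k * t)) =
    (Complex.exp ((((n : ℝ) + 1) / 2 * t : ℝ) * Complex.I) *
      ((A - C * Complex.I : ℂ) * curveX α n t + (D + B * Complex.I : ℂ) * curveY α n t)).re := by
  set m : ℝ := ((n : ℝ) + 1) / 2 with hm
  have h1 : ∑ k ∈ Finset.Icc 1 n, Real.cos (((k : ℝ) - m) * α) * Real.sin (((k : ℝ) - m) * t) = 0 :=
    sum_Icc_odd_eq_zero n (f := fun x => Real.cos (x * α) * Real.sin (x * t)) (fun x => by simp)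
  have h2 : ∑ k ∈ Finset.Icc 1 n, Real.sin (((k : ℝ) - m) * α) * Real.cos (((k : ℝ) - m) * t) = 0 :=
    sum_Icc_odd_eq_zero n (f := fun x => Real.sin (x * α) * Real.cos (x * t)) (fun x => by simp)
  have hre : (Complex.exp ((m * t : ℝ) * Complex.I) *
      ((A - C * Complex.I : ℂ) * curveX α n t + (D + B * Complex.I : ℂ) * curveY α n t)).re =
      (A * Real.cos (m * t) + C * Real.sin (m * t)) * curveX α n t +
      (D * Real.cos (m * t) - B * Real.sin (m * t)) * curveY α n t := by
    rw [Complex.mul_re, Complex.exp_ofReal_mul_I_re, Complex.exp_ofReal_mul_I_im]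
    simp
    ring
  rw [hre]
  have hterm : ∀ k : ℕ,
      ((A * Real.cos (k * α - m * α) + B * Real.sin (k * α - m * α)) * Real.cos (k * t) +
        (C * Real.cos (k * α - m * α) + D * Real.sin (k * α - m * α)) * Real.sin (k * t)) =
      (A * Real.cos (m * t) + C * Real.sin (m * t)) *
        (Real.cos (((k : ℝ) - m) * α) * Real.cos (((k : ℝ) - m) * t)) +
      (D * Real.cos (m * t) - B * Real.sin (m * t)) *
        (Real.sin (((k : ℝ) - m) * α) * Real.sin (((k : ℝ) - m) * t)) +
      (C * Real.cos (m * t) - A * Real.sin (m * t)) *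
        (Real.cos (((k : ℝ) - m) * α) * Real.sin (((k : ℝ) - m) * t)) +
      (B * Real.cos (m * t) + D * Real.sin (m * t)) *
        (Real.sin (((k : ℝ) - m) * α) * Real.cos (((k : ℝ) - m) * t)) := by
    intro k
    have e : (k : ℝ) * t = (k - m) * t + m * t := by ring
    rw [e, Real.cos_add, Real.sin_add, sub_mul]
    ring_nf
  simp_rw [hterm, Finset.sum_add_distrib, ← Finset.mul_sum, h1, h2]
  simp [curveX, curveY, ← hm]

/-- The Kac-Rice formula for the random trigonometric polynomial `f_n`. -/
theorem IsCoefficientPair.lintegral_zeros {Ω : Type*} [MeasurableSpace Ω] {P : Measure Ω}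
    [IsProbabilityMeasure P] {a b : ℕ → Ω → ℝ} {α : ℝ} (h : IsCoefficientPair P a b α)
    (hα : Real.sin α ≠ 0) {n : ℕ} (hn : 1 ≤ n) {x' y' : ℝ → ℝ}
    (hx : ∀ t, HasDerivAt (curveX α n) (x' t) t) (hy : ∀ t, HasDerivAt (curveY α n) (y' t) t)
    (hx' : Continuous x') (hy' : Continuous y')
    (h0 : ∀ t, curveX α n t ^ 2 + curveY α n t ^ 2 ≠ 0) :
    AEMeasurable (zeros a b n) P ∧
    ENNReal.ofReal Real.pi * expectedZeros P a b n =
      ∫⁻ t in Icc 0 (2 * Real.pi), ENNReal.ofReal √((((n : ℝ) + 1) / 2) ^ 2 +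
        ((curveX α n t * y' t - x' t * curveY α n t) /
          (curveX α n t ^ 2 + curveY α n t ^ 2)) ^ 2) := by
  obtain ⟨φ, hφ, hφm, hφl, hφa⟩ := h.left.exists_map_eq hα ((n + 1) / 2 * α)
  obtain ⟨ψ, hψ, hψm, hψl, hψb⟩ := h.right.exists_map_eq hα ((n + 1) / 2 * α)
  have hind : IndepFun (fun ω => φ fun k => a (k + 1) ω) (fun ω => ψ fun k => b (k + 1) ω) P :=
    h.indep.comp hφ hψ
  have hlaw := (indepFun_iff_map_prod_eq_prod_map_map hφm hψm).1 hind
  rw [hφl, hψl] at hlaw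
  let R : (ℝ × ℝ) × ℝ × ℝ → ℂ × ℂ := fun p =>
    ((p.1.1 - p.2.1 * Complex.I : ℂ), (p.2.2 + p.1.2 * Complex.I : ℂ))
  let Z : Ω → ℂ × ℂ := fun ω => R (φ fun k => a (k + 1) ω, ψ fun k => b (k + 1) ω)
  have hR : Measurable R := by fun_prop
  have hZm : AEMeasurable Z P := hR.comp_aemeasurable (hφm.prodMk hψm)
  have hZ : P.map Z = complexGaussian.prod complexGaussian := by
    rw [← map_rearrange_gaussianReal, ← hlaw, AEMeasurable.map_map_of_aemeasurable
      hR.aemeasurable (hφm.prodMk hψm)]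
    rfl
  have hxc : Continuous (curveX α n) := continuous_iff_continuousAt.2 fun t => (hx t).continuousAt
  have hyc : Continuous (curveY α n) := continuous_iff_continuousAt.2 fun t => (hy t).continuousAt
  set N : ℂ × ℂ → ℝ≥0∞ := fun z => ((zeroCount (fun t =>
    (Complex.exp ((((n : ℝ) + 1) / 2 * t : ℝ) * Complex.I) *
      (z.1 * curveX α n t + z.2 * curveY α n t)).re) (Icc 0 (2 * Real.pi)) : ℕ∞) : ℝ≥0∞) with hN
  have hNm : Measurable N := measurable_zeroCount (f := fun (z : ℂ × ℂ) t =>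
    (Complex.exp ((((n : ℝ) + 1) / 2 * t : ℝ) * Complex.I) *
      (z.1 * curveX α n t + z.2 * curveY α n t)).re) (by fun_prop) _ _
  have hae : zeros a b n =ᵐ[P] fun ω => N (Z ω) := by
    have ha : ∀ᵐ ω ∂P, ∀ k : ℕ, 1 ≤ k → _ := ae_all_iff.2 fun k =>
      Filter.eventually_imp_distrib_left.2 fun hk => hφa k hk
    have hb : ∀ᵐ ω ∂P, ∀ k : ℕ, 1 ≤ k → _ := ae_all_iff.2 fun k =>
      Filter.eventually_imp_distrib_left.2 fun hk => hψb k hk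
    filter_upwards [ha, hb] with ω ha hb
    have hn0 : (1 / √(n : ℝ)) ≠ 0 := by
      have : (0 : ℝ) < n := by exact_mod_cast hn
      positivity
    simp only [zeros, zeroCount, hN]
    congr 2
    ext t
    simp only [mem_ofPred_eq]
    refine and_congr_right fun _ => ?_
    rw [trigPoly, mul_eq_zero, or_iff_right hn0]
    rw [Finset.sum_congr rfl fun k hk => by
      rw [ha k (Finset.mem_Icc.1 hk).1, hb k (Finset.mem_Icc.1 hk).1]]
    rw [sum_trig_eq_re]
  refine ⟨(hNm.comp_aemeasurable hZm).congr hae.symm, ?_⟩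
  rw [expectedZeros, lintegral_congr_ae hae, ← lintegral_map' (f := N) hNm.aemeasurable hZm, hZ]
  exact lintegral_zeroCount_complexGaussian hx hy hx' hy' h0 _ _ _

/-! ### Dirichlet kernel and angular speed. -/

/-- The centred Dirichlet kernel `∑ cos ((k - (n + 1) / 2) x)`, equal to
`sin (n x / 2) / sin (x / 2)`. -/
noncomputable def kernel (n : ℕ) (x : ℝ) : ℝ :=
  ∑ k ∈ Finset.Icc 1 n, Real.cos (((k : ℝ) - (n + 1) / 2) * x)

/-- The derivative of the centred Dirichlet kernel. -/
noncomputable def kernelDeriv (n : ℕ) (x : ℝ) : ℝ :=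
  ∑ k ∈ Finset.Icc 1 n, -Real.sin (((k : ℝ) - (n + 1) / 2) * x) * ((k : ℝ) - (n + 1) / 2)

theorem hasDerivAt_kernel (n : ℕ) (x : ℝ) : HasDerivAt (kernel n) (kernelDeriv n x) x := by
  unfold kernel kernelDeriv
  refine HasDerivAt.fun_sum fun k _ => ?_
  simpa using ((hasDerivAt_id x).const_mul ((k : ℝ) - (n + 1) / 2)).cos

@[fun_prop]
theorem continuous_kernel (n : ℕ) : Continuous (kernel n) := by unfold kernel; fun_prop

@[fun_prop]
theorem continuous_kernelDeriv (n : ℕ) : Continuous (kernelDeriv n) := by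
  unfold kernelDeriv; fun_prop

theorem kernel_mul_sin (n : ℕ) (x : ℝ) : kernel n x * Real.sin (x / 2) = Real.sin (n * x / 2) := by
  -- The centre c is decoupled from the number of terms N, so that the telescoping induction can run
  -- with c fixed.
  have key : ∀ (c : ℝ) (N : ℕ), 2 * ((∑ k ∈ Finset.Icc 1 N, Real.cos (((k : ℝ) - c) * x)) *
      Real.sin (x / 2)) = Real.sin ((N + 1 / 2 - c) * x) - Real.sin ((1 / 2 - c) * x) := by
    intro c N
    induction N with
    | zero => simp
    | succ N ih =>
      rw [Finset.sum_Icc_succ_top (by omega), add_mul, mul_add, ih]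
      have e1 : ((N : ℝ) + 1 / 2 - c) * x = ((N + 1 : ℕ) - c) * x - x / 2 := by push_cast; ring
      have e2 : (((N + 1 : ℕ) : ℝ) + 1 / 2 - c) * x = ((N + 1 : ℕ) - c) * x + x / 2 := by ring
      rw [e1, e2, Real.sin_sub, Real.sin_add]
      ring
  have := key ((n + 1) / 2) n
  have e1 : ((n : ℝ) + 1 / 2 - (n + 1) / 2) * x = n * x / 2 := by ring
  have e2 : ((1 : ℝ) / 2 - (n + 1) / 2) * x = -(n * x / 2) := by ring
  rw [e1, e2, Real.sin_neg] at this
  unfold kernel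
  linarith

theorem kernelDeriv_mul_sin (n : ℕ) (x : ℝ) :
    kernelDeriv n x * Real.sin (x / 2) + kernel n x * (Real.cos (x / 2) / 2) =
      n / 2 * Real.cos (n * x / 2) := by
  have h1 : HasDerivAt (fun x => kernel n x * Real.sin (x / 2))
      (kernelDeriv n x * Real.sin (x / 2) + kernel n x * (Real.cos (x / 2) * (1 / 2))) x :=
    (hasDerivAt_kernel n x).mul ((hasDerivAt_id x).div_const 2).sin
  have h2 : HasDerivAt (fun x : ℝ => Real.sin (n * x / 2))
      (Real.cos (n * x / 2) * (n * 1 / 2)) x :=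
    (((hasDerivAt_id x).const_mul (n : ℝ)).div_const 2).sin
  have h3 : (fun x => kernel n x * Real.sin (x / 2)) = fun x : ℝ => Real.sin (n * x / 2) :=
    funext (kernel_mul_sin n)
  rw [h3] at h1
  have := h1.unique h2
  linarith

theorem kernel_add_two_pi (n : ℕ) (x : ℝ) :
    kernel n (x + 2 * Real.pi) = (-1) ^ (n + 1) * kernel n x := by
  unfold kernel
  rw [Finset.mul_sum]
  refine Finset.sum_congr rfl fun k _ => ?_
  have e : ((k : ℝ) - (n + 1) / 2) * (x + 2 * Real.pi) =
      (k - (n + 1) / 2) * x + k * (2 * Real.pi) - (n + 1 : ℕ) * Real.pi := by push_cast; ring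
  rw [e, Real.cos_sub_nat_mul_pi, Real.cos_add_nat_mul_two_pi]

theorem kernelDeriv_add_two_pi (n : ℕ) (x : ℝ) :
    kernelDeriv n (x + 2 * Real.pi) = (-1) ^ (n + 1) * kernelDeriv n x := by
  unfold kernelDeriv
  rw [Finset.mul_sum]
  refine Finset.sum_congr rfl fun k _ => ?_
  have e : ((k : ℝ) - (n + 1) / 2) * (x + 2 * Real.pi) =
      (k - (n + 1) / 2) * x + k * (2 * Real.pi) - (n + 1 : ℕ) * Real.pi := by push_cast; ring
  rw [e, Real.sin_sub_nat_mul_pi, Real.sin_add_nat_mul_two_pi]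
  ring

/-- Together with `curveY_eq`, this exhibits the curve as (K(t+α), K(t-α)) rotated by -π/4 and
scaled by 1/√2, so both have the same angular speed. -/
theorem curveX_eq (α : ℝ) (n : ℕ) (t : ℝ) :
    curveX α n t = (kernel n (t + α) + kernel n (t - α)) / 2 := by
  unfold curveX kernel
  rw [← Finset.sum_add_distrib, Finset.sum_div]
  refine Finset.sum_congr rfl fun k _ => ?_
  rw [mul_add, mul_sub, Real.cos_add, Real.cos_sub]
  ring

theorem curveY_eq (α : ℝ) (n : ℕ) (t : ℝ) :
    curveY α n t = (kernel n (t - α) - kernel n (t + α)) / 2 := by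
  unfold curveY kernel
  rw [← Finset.sum_sub_distrib, Finset.sum_div]
  refine Finset.sum_congr rfl fun k _ => ?_
  rw [mul_add, mul_sub, Real.cos_add, Real.cos_sub]
  ring

/-- A common zero would make the sines of n(t+α)/2 and n(t-α)/2 vanish, hence also the sine of their
difference nα. -/
theorem kernel_sq_add_sq_pos {α : ℝ} {n : ℕ} (h : Real.sin (n * α) ≠ 0) (t : ℝ) :
    0 < kernel n (t + α) ^ 2 + kernel n (t - α) ^ 2 := by
  by_contra hneg
  have h1 : kernel n (t + α) = 0 := by
    nlinarith [sq_nonneg (kernel n (t + α)), sq_nonneg (kernel n (t - α))]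
  have h2 : kernel n (t - α) = 0 := by
    nlinarith [sq_nonneg (kernel n (t + α)), sq_nonneg (kernel n (t - α))]
  have h3 := kernel_mul_sin n (t + α)
  have h4 := kernel_mul_sin n (t - α)
  rw [h1, zero_mul] at h3
  rw [h2, zero_mul] at h4
  apply h
  rw [show (n : ℝ) * α = n * (t + α) / 2 - n * (t - α) / 2 by ring, Real.sin_sub, ← h3, ← h4]
  simp

/-- The angular speed of the planar curve `t ↦ (kernel n (t + α), kernel n (t - α))`. -/
noncomputable def angularSpeed (α : ℝ) (n : ℕ) (t : ℝ) : ℝ :=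
  (kernel n (t + α) * kernelDeriv n (t - α) - kernelDeriv n (t + α) * kernel n (t - α)) /
    (kernel n (t + α) ^ 2 + kernel n (t - α) ^ 2)

theorem continuous_angularSpeed {α : ℝ} {n : ℕ} (h : Real.sin (n * α) ≠ 0) :
    Continuous (angularSpeed α n) := by
  unfold angularSpeed
  exact Continuous.div (by fun_prop) (by fun_prop) fun t => (kernel_sq_add_sq_pos h t).ne'

theorem angularSpeed_periodic (α : ℝ) (n : ℕ) :
    Function.Periodic (angularSpeed α n) (2 * Real.pi) := by
  intro t
  unfold angularSpeed
  rw [show t + 2 * Real.pi + α = t + α + 2 * Real.pi by ring,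
    show t + 2 * Real.pi - α = t - α + 2 * Real.pi by ring]
  simp only [kernel_add_two_pi, kernelDeriv_add_two_pi]
  have h : ((-1 : ℝ) ^ (n + 1)) ^ 2 = 1 := by rw [← pow_mul, mul_comm, pow_mul]; simp
  congr 1
  · linear_combination (kernel n (t + α) * kernelDeriv n (t - α) -
      kernelDeriv n (t + α) * kernel n (t - α)) * h
  · linear_combination (kernel n (t + α) ^ 2 + kernel n (t - α) ^ 2) * h

/-- This separates the scales: apart from a term of order 1/n, the speed depends on t through
sin((t±α)/2), on the fast phase n(t-α)/2 and on nα. It follows by eliminating the kernels and their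
derivatives through `kernel_mul_sin` and `kernelDeriv_mul_sin`. -/
theorem angularSpeed_eq {α : ℝ} {n : ℕ} (hn : 1 ≤ n) {t : ℝ} (h1 : Real.sin ((t + α) / 2) ≠ 0)
    (h2 : Real.sin ((t - α) / 2) ≠ 0) :
    2 / n * angularSpeed α n t =
      (Real.sin (n * α) * (Real.sin ((t + α) / 2) * Real.sin ((t - α) / 2)) -
        (n : ℝ)⁻¹ * Real.sin α * (Real.sin (n * (t - α) / 2 + n * α) *
          Real.sin (n * (t - α) / 2))) /
      (Real.sin ((t - α) / 2) ^ 2 * Real.sin (n * (t - α) / 2 + n * α) ^ 2 +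
        Real.sin ((t + α) / 2) ^ 2 * Real.sin (n * (t - α) / 2) ^ 2) := by
  have hn0 : (n : ℝ) ≠ 0 := by positivity
  have e1 : (n : ℝ) * (t - α) / 2 + n * α = n * (t + α) / 2 := by ring
  have e2 : (n : ℝ) * α = n * (t + α) / 2 - n * (t - α) / 2 := by ring
  have e3 : Real.sin α = Real.sin ((t + α) / 2) * Real.cos ((t - α) / 2) -
      Real.cos ((t + α) / 2) * Real.sin ((t - α) / 2) := by
    rw [← Real.sin_sub]; ring_nf
  rw [e1]
  conv_rhs => rw [e2, Real.sin_sub, e3]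
  have k1 := kernel_mul_sin n (t + α)
  have k2 := kernel_mul_sin n (t - α)
  have d1 := kernelDeriv_mul_sin n (t + α)
  have d2 := kernelDeriv_mul_sin n (t - α)
  rw [← k1, ← k2]
  set p := Real.sin ((t + α) / 2)
  set q := Real.sin ((t - α) / 2)
  have c1 : Real.cos (n * (t + α) / 2) = 2 / n * (kernelDeriv n (t + α) * p +
      kernel n (t + α) * (Real.cos ((t + α) / 2) / 2)) := by
    rw [d1]; field_simp
  have c2 : Real.cos (n * (t - α) / 2) = 2 / n * (kernelDeriv n (t - α) * q +
      kernel n (t - α) * (Real.cos ((t - α) / 2) / 2)) := by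
    rw [d2]; field_simp
  rw [c1, c2]
  have hden : q ^ 2 * (kernel n (t + α) * p) ^ 2 + p ^ 2 * (kernel n (t - α) * q) ^ 2 =
      (p * q) ^ 2 * (kernel n (t + α) ^ 2 + kernel n (t - α) ^ 2) := by ring
  have hpq : (p * q) ^ 2 ≠ 0 := by positivity
  rw [hden, angularSpeed, ← mul_div_assoc]
  rw [← mul_div_mul_left (2 / (n : ℝ) * _) _ hpq]
  congr 1
  field_simp
  ring

/-- A combination of two translates of the kernel has few zeros. -/
theorem zeroCount_kernel_le {α A B : ℝ} (hAB : A ^ 2 ≠ B ^ 2) {n : ℕ} (hn : 1 ≤ n) :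
    zeroCount (fun t => A * kernel n (t + α) + B * kernel n (t - α)) (Icc 0 (2 * Real.pi)) ≤ n := by
  set m : ℝ := ((n : ℝ) + 1) / 2 with hm
  -- Up to a unimodular factor the function is a polynomial in e^{it} of degree at most n-1 with
  -- these coefficients; |A| ≠ |B| makes them nonzero.
  let c : ℕ → ℂ := fun k => A * Complex.exp (((k + 1 - m) * α : ℝ) * Complex.I) +
    B * Complex.exp ((-((k + 1 - m) * α) : ℝ) * Complex.I)
  have hc : ∀ k, c k ≠ 0 := by
    intro k hk
    have h1 := congrArg norm (eq_neg_of_add_eq_zero_left hk)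
    rw [norm_neg, norm_mul, norm_mul, Complex.norm_exp_ofReal_mul_I, Complex.norm_exp_ofReal_mul_I,
      mul_one, mul_one, Complex.norm_real, Complex.norm_real] at h1
    exact hAB ((sq_eq_sq_iff_abs_eq_abs A B).2 h1)
  let p : Polynomial ℂ := ∑ k ∈ Finset.range n, Polynomial.monomial k (c k)
  have hcoeff : p.coeff 0 = c 0 := by
    simp only [p, Polynomial.finsetSum_coeff, Polynomial.coeff_monomial]
    rw [Finset.sum_ite_eq' (Finset.range n) 0 c, if_pos (Finset.mem_range.2 hn)]
  have hp0 : p ≠ 0 := by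
    intro h
    apply hc 0
    rw [← hcoeff, h, Polynomial.coeff_zero]
  have hdeg : p.natDegree ≤ n - 1 := by
    refine Polynomial.natDegree_sum_le_of_forall_le _ _ fun k hk => ?_
    exact (Polynomial.natDegree_monomial_le _).trans (by have := Finset.mem_range.1 hk; omega)
  have heval : ∀ t : ℝ, ((A * kernel n (t + α) + B * kernel n (t - α) : ℝ) : ℂ) =
      Complex.exp (((1 - m) * t : ℝ) * Complex.I) * p.eval (Complex.exp (t * Complex.I)) := by
    intro t
    have hk : ∀ x : ℝ, (kernel n x : ℂ) =
        ∑ k ∈ Finset.Icc 1 n, Complex.exp ((((k : ℝ) - m) * x : ℝ) * Complex.I) := by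
      intro x
      have hs : ∑ k ∈ Finset.Icc 1 n, Real.sin (((k : ℝ) - m) * x) = 0 :=
        sum_Icc_odd_eq_zero n (f := fun y => Real.sin (y * x)) (fun y => by simp)
      have : ∑ k ∈ Finset.Icc 1 n, Complex.exp ((((k : ℝ) - m) * x : ℝ) * Complex.I) =
          ((∑ k ∈ Finset.Icc 1 n, Real.cos (((k : ℝ) - m) * x) : ℝ) : ℂ) +
          ((∑ k ∈ Finset.Icc 1 n, Real.sin (((k : ℝ) - m) * x) : ℝ) : ℂ) * Complex.I := by
        simp_rw [Complex.exp_mul_I, Finset.sum_add_distrib, ← Finset.sum_mul]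
        push_cast
        rfl
      rw [this, hs]
      simp [kernel, hm]
    rw [Complex.ofReal_add, Complex.ofReal_mul, Complex.ofReal_mul, hk, hk]
    simp only [p, Polynomial.eval_finsetSum, Polynomial.eval_monomial]
    rw [Finset.mul_sum, Finset.mul_sum, Finset.mul_sum, ← Finset.sum_add_distrib]
    refine Finset.sum_nbij' (fun k => k - 1) (fun k => k + 1) ?_ ?_ ?_ ?_ ?_
    · intro k hk; simp only [Finset.mem_Icc, Finset.mem_range] at hk ⊢; omega
    · intro k hk; simp only [Finset.mem_Icc, Finset.mem_range] at hk ⊢; omega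
    · intro k hk; simp only [Finset.mem_Icc] at hk; omega
    · intro k _; rfl
    · intro k hk
      obtain ⟨j, rfl⟩ := Nat.exists_eq_add_of_le' (Finset.mem_Icc.1 hk).1
      have hE : ∀ x y z : ℂ, Complex.exp x * (Complex.exp y * Complex.exp z) =
          Complex.exp (x + (y + z)) := fun x y z => by rw [Complex.exp_add, Complex.exp_add]
      rw [Nat.add_sub_cancel, ← Complex.exp_nat_mul, add_mul (_ * _), mul_add (Complex.exp _),
        mul_assoc (A : ℂ),
        mul_assoc (B : ℂ), mul_left_comm (Complex.exp _) (A : ℂ),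
        mul_left_comm (Complex.exp _) (B : ℂ), hE, hE]
      congr 3 <;> push_cast <;> ring
  -- The endpoint 2π gives the same point of the circle as 0 and is counted apart, which raises n-1
  -- to n.
  have hsub : {t : ℝ | t ∈ Icc 0 (2 * Real.pi) ∧ A * kernel n (t + α) + B * kernel n (t - α) = 0} ⊆
      insert (2 * Real.pi) {t | t ∈ Ico 0 (2 * Real.pi) ∧
        Complex.exp (t * Complex.I) ∈ (p.roots.toFinset : Set ℂ)} := by
    rintro t ⟨ht, h0⟩
    rcases ht.2.eq_or_lt with h | h
    · exact Or.inl h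
    · refine Or.inr ⟨⟨ht.1, h⟩, ?_⟩
      have h1 := heval t
      rw [h0, Complex.ofReal_zero] at h1
      have h2 := (mul_eq_zero.1 h1.symm).resolve_left (Complex.exp_ne_zero _)
      simpa [hp0] using h2
  have hinj : InjOn (fun t : ℝ => Complex.exp (t * Complex.I)) {t | t ∈ Ico 0 (2 * Real.pi) ∧
        Complex.exp (t * Complex.I) ∈ (p.roots.toFinset : Set ℂ)} := by
    intro s hs t ht hst
    obtain ⟨k, hk⟩ := Complex.exp_eq_exp_iff_exists_int.1 hst
    have hk' : s = t + k * (2 * Real.pi) := by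
      have h1 : ((s : ℂ) - (t + k * (2 * Real.pi))) * Complex.I = 0 := by linear_combination hk
      have h2 := (mul_eq_zero.1 h1).resolve_right Complex.I_ne_zero
      have h3 : (s : ℂ) = ((t + k * (2 * Real.pi) : ℝ) : ℂ) := by
        push_cast; linear_combination h2
      exact_mod_cast h3
    have h1 : (-1 : ℝ) < k := by
      by_contra hcon
      push Not at hcon
      nlinarith [hs.1.1, ht.1.2, Real.pi_pos]
    have h2 : (k : ℝ) < 1 := by
      by_contra hcon
      push Not at hcon
      nlinarith [hs.1.2, ht.1.1, Real.pi_pos]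
    have h1' : -1 < k := by exact_mod_cast h1
    have h2' : k < 1 := by exact_mod_cast h2
    obtain rfl : k = 0 := by omega
    simpa using hk'
  have hle : {t : ℝ | t ∈ Ico 0 (2 * Real.pi) ∧
        Complex.exp (t * Complex.I) ∈ (p.roots.toFinset : Set ℂ)}.encard ≤ (n - 1 : ℕ) := by
    rw [← hinj.encard_image]
    refine (encard_le_encard (t := (p.roots.toFinset : Set ℂ)) ?_).trans ?_
    · rintro _ ⟨t, ht, rfl⟩; exact ht.2
    · rw [encard_coe_eq_coe_finsetCard]
      exact_mod_cast (Multiset.toFinset_card_le _).trans ((Polynomial.card_roots' p).trans hdeg)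
  calc zeroCount (fun t => A * kernel n (t + α) + B * kernel n (t - α)) (Icc 0 (2 * Real.pi))
      ≤ _ := encard_le_encard hsub
    _ ≤ _ := encard_insert_le _ _
    _ ≤ ((n - 1 : ℕ) : ℕ∞) + 1 := by gcongr
    _ = n := by exact_mod_cast congrArg (Nat.cast : ℕ → ℕ∞) (Nat.sub_add_cancel hn)

/-- By `lintegral_zeroCount_rotate` the total variation is the integral over η in (0, π] of the zero
count of a combination of two kernel translates. This count is at most n except at the two angles
where the coefficients have equal modulus. -/
theorem lintegral_abs_angularSpeed_le {α : ℝ} {n : ℕ} (hn : 1 ≤ n) (h : Real.sin (n * α) ≠ 0) :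
    ∫⁻ t in Icc 0 (2 * Real.pi), ENNReal.ofReal |angularSpeed α n t| ≤
      ENNReal.ofReal (n * Real.pi) := by
  let w : ℝ → ℂ := fun t => kernel n (t + α) + kernel n (t - α) * Complex.I
  let w' : ℝ → ℂ := fun t => kernelDeriv n (t + α) + kernelDeriv n (t - α) * Complex.I
  have hw : ∀ t, HasDerivAt w (w' t) t := fun t =>
    ((hasDerivAt_kernel n (t + α)).comp_add_const t α).ofReal_comp.add
      (((hasDerivAt_kernel n (t - α)).comp_sub_const t α).ofReal_comp.mul_const Complex.I)
  have hre : ∀ t, (w t).re = kernel n (t + α) := fun t => by simp [w]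
  have him : ∀ t, (w t).im = kernel n (t - α) := fun t => by simp [w]
  have hre' : ∀ t, (w' t).re = kernelDeriv n (t + α) := fun t => by simp [w']
  have him' : ∀ t, (w' t).im = kernelDeriv n (t - α) := fun t => by simp [w']
  have hns : ∀ t, Complex.normSq (w t) = kernel n (t + α) ^ 2 + kernel n (t - α) ^ 2 := fun t => by
    rw [Complex.normSq_apply, hre, him]; ring
  have h0 : ∀ t, w t ≠ 0 := fun t h0 => by
    have := kernel_sq_add_sq_pos h t
    rw [← hns, h0] at this
    simp at this
  have hquot : ∀ t, (w' t / w t).im = angularSpeed α n t := by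
    intro t
    rw [Complex.div_im, hns, hre, him, hre', him', angularSpeed]
    ring
  have hcr := lintegral_zeroCount_rotate hw (by fun_prop) h0 0 (2 * Real.pi)
  simp_rw [hquot] at hcr
  rw [← hcr]
  have hcount : ∀ η : ℝ, η ∈ Ioc 0 Real.pi → η ∉ ({Real.pi / 4, 3 * Real.pi / 4} : Set ℝ) →
      ((zeroCount (fun t => (Complex.exp (η * Complex.I) * w t).re) (Icc 0 (2 * Real.pi)) : ℕ∞) :
        ℝ≥0∞) ≤ n := by
    intro η hη hη'
    have hf : (fun t => (Complex.exp (η * Complex.I) * w t).re) =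
        fun t => Real.cos η * kernel n (t + α) + (-Real.sin η) * kernel n (t - α) := by
      ext t
      rw [Complex.mul_re, Complex.exp_ofReal_mul_I_re, Complex.exp_ofReal_mul_I_im, hre, him]
      ring
    have hne : Real.cos η ^ 2 ≠ (-Real.sin η) ^ 2 := by
      intro heq
      have h2 : Real.cos (2 * η) = 0 := by rw [Real.cos_two_mul']; linarith [neg_sq (Real.sin η)]
      obtain ⟨k, hk⟩ := Real.cos_eq_zero_iff.1 h2
      apply hη'
      have hk0 : (-1 : ℝ) < k := by
        by_contra hcon
        push Not at hcon
        nlinarith [hη.1, Real.pi_pos]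
      have hk2 : (k : ℝ) < 2 := by
        by_contra hcon
        push Not at hcon
        nlinarith [hη.2, Real.pi_pos]
      have hk0' : -1 < k := by exact_mod_cast hk0
      have hk2' : k < 2 := by exact_mod_cast hk2
      have : k = 0 ∨ k = 1 := by omega
      rcases this with rfl | rfl
      · left; push_cast at hk; linarith
      · right; push_cast at hk; simp only [mem_singleton_iff]; linarith
    rw [hf]
    have := zeroCount_kernel_le (α := α) hne hn
    calc ((zeroCount (fun t => Real.cos η * kernel n (t + α) + -Real.sin η * kernel n (t - α))
          (Icc 0 (2 * Real.pi)) : ℕ∞) : ℝ≥0∞) ≤ ((n : ℕ∞) : ℝ≥0∞) := by exact_mod_cast this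
      _ = n := by simp
  calc _ ≤ ∫⁻ η in Ioc 0 Real.pi, (n : ℝ≥0∞) := by
        refine lintegral_mono_ae ?_
        have hfin : ∀ᵐ η ∂(volume.restrict (Ioc 0 Real.pi)),
            η ∉ ({Real.pi / 4, 3 * Real.pi / 4} : Set ℝ) :=
          ae_restrict_of_ae (measure_eq_zero_iff_ae_notMem.1 ((Set.toFinite _).measure_zero _))
        filter_upwards [hfin, ae_restrict_mem measurableSet_Ioc] with η h1 h2 using hcount η h2 h1
    _ = _ := by
        rw [lintegral_const, ENNReal.ofReal_mul (by positivity)]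
        simp

/-- The normalized expected number of zeros of `f_n` in terms of the angular speed. -/
noncomputable def normalizedZeros (α : ℝ) (n : ℕ) : ℝ :=
  1 / (2 * Real.pi) * ∫ t in (0 : ℝ)..2 * Real.pi,
    √((1 + (n : ℝ)⁻¹) ^ 2 + (2 / n * angularSpeed α n t) ^ 2)

theorem IsCoefficientPair.expectedZeros_div {Ω : Type*} [MeasurableSpace Ω] {P : Measure Ω}
    [IsProbabilityMeasure P] {a b : ℕ → Ω → ℝ} {α : ℝ} (h : IsCoefficientPair P a b α)
    (hα : Real.sin α ≠ 0) {n : ℕ} (hn : 1 ≤ n) (hnα : Real.sin (n * α) ≠ 0) :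
    AEMeasurable (zeros a b n) P ∧ expectedZeros P a b n ≠ ⊤ ∧
      (expectedZeros P a b n).toReal / n = normalizedZeros α n := by
  have hX : curveX α n = fun t => (kernel n (t + α) + kernel n (t - α)) / 2 :=
    funext (curveX_eq α n)
  have hY : curveY α n = fun t => (kernel n (t - α) - kernel n (t + α)) / 2 :=
    funext (curveY_eq α n)
  have hp : ∀ t, HasDerivAt (fun t => kernel n (t + α)) (kernelDeriv n (t + α)) t := fun t =>
    (hasDerivAt_kernel n (t + α)).comp_add_const t α
  have hm : ∀ t, HasDerivAt (fun t => kernel n (t - α)) (kernelDeriv n (t - α)) t := fun t =>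
    (hasDerivAt_kernel n (t - α)).comp_sub_const t α
  have h0 : ∀ t, curveX α n t ^ 2 + curveY α n t ^ 2 =
      (kernel n (t + α) ^ 2 + kernel n (t - α) ^ 2) / 2 := fun t => by
    rw [curveX_eq, curveY_eq]; ring
  obtain ⟨hmeas, hE⟩ := h.lintegral_zeros hα hn
    (x' := fun t => (kernelDeriv n (t + α) + kernelDeriv n (t - α)) / 2)
    (y' := fun t => (kernelDeriv n (t - α) - kernelDeriv n (t + α)) / 2)
    (fun t => hX ▸ ((hp t).add (hm t)).div_const 2) (fun t => hY ▸ ((hm t).sub (hp t)).div_const 2)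
    (by fun_prop) (by fun_prop)
    (fun t => by rw [h0]; exact (half_pos (kernel_sq_add_sq_pos hnα t)).ne')
  have hn0 : (0 : ℝ) < n := by exact_mod_cast hn
  have hint : ∀ t, √((((n : ℝ) + 1) / 2) ^ 2 + ((curveX α n t *
      ((kernelDeriv n (t - α) - kernelDeriv n (t + α)) / 2) -
      (kernelDeriv n (t + α) + kernelDeriv n (t - α)) / 2 * curveY α n t) /
        (curveX α n t ^ 2 + curveY α n t ^ 2)) ^ 2) =
      n / 2 * √((1 + (n : ℝ)⁻¹) ^ 2 + (2 / n * angularSpeed α n t) ^ 2) := by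
    intro t
    have hq : (curveX α n t * ((kernelDeriv n (t - α) - kernelDeriv n (t + α)) / 2) -
      (kernelDeriv n (t + α) + kernelDeriv n (t - α)) / 2 * curveY α n t) /
        (curveX α n t ^ 2 + curveY α n t ^ 2) = angularSpeed α n t := by
      rw [h0, angularSpeed, div_eq_div_iff (half_pos (kernel_sq_add_sq_pos hnα t)).ne'
        (kernel_sq_add_sq_pos hnα t).ne', curveX_eq, curveY_eq]
      ring
    rw [hq]
    conv_rhs => rw [← Real.sqrt_sq (by positivity : (0 : ℝ) ≤ n / 2), ← Real.sqrt_mul (sq_nonneg _)]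
    congr 1
    field_simp
  simp_rw [hint] at hE
  have hcont := continuous_angularSpeed hnα
  have hI : ∫⁻ t in Icc 0 (2 * Real.pi), ENNReal.ofReal
      (n / 2 * √((1 + (n : ℝ)⁻¹) ^ 2 + (2 / n * angularSpeed α n t) ^ 2)) =
      ENNReal.ofReal (∫ t in Icc 0 (2 * Real.pi),
        n / 2 * √((1 + (n : ℝ)⁻¹) ^ 2 + (2 / n * angularSpeed α n t) ^ 2)) := by
    rw [ofReal_integral_eq_lintegral_ofReal]
    · exact (by fun_prop : Continuous fun t =>
        n / 2 * √((1 + (n : ℝ)⁻¹) ^ 2 + (2 / n * angularSpeed α n t) ^ 2)).integrableOn_Icc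
    · exact Filter.Eventually.of_forall fun t => by positivity
  rw [hI, integral_Icc_eq_integral_Ioc, ← intervalIntegral.integral_of_le (by positivity),
    intervalIntegral.integral_const_mul] at hE
  have hpi : ENNReal.ofReal Real.pi ≠ 0 := by simpa using Real.pi_pos
  refine ⟨hmeas, fun htop => ?_, ?_⟩
  · rw [htop, ENNReal.mul_top hpi] at hE
    exact ENNReal.ofReal_ne_top hE.symm
  · have h2 := congrArg ENNReal.toReal hE
    rw [ENNReal.toReal_mul, ENNReal.toReal_ofReal Real.pi_pos.le, ENNReal.toReal_ofReal] at h2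
    · rw [normalizedZeros, div_eq_iff hn0.ne', ← mul_right_inj' Real.pi_ne_zero, h2]
      generalize (∫ t in (0 : ℝ)..2 * Real.pi,
        √((1 + (n : ℝ)⁻¹) ^ 2 + (2 / n * angularSpeed α n t) ^ 2)) = I
      have := Real.pi_pos
      field_simp
    · exact mul_nonneg (by positivity) (intervalIntegral.integral_nonneg (by positivity)
        fun t _ => Real.sqrt_nonneg _)

/-! ### The limiting angular speed. -/

/-- The limiting normalized angular speed at slow variable `t` and fast phase `u`. -/
noncomputable def limitSpeed (α β t u : ℝ) : ℝ :=
  |Real.sin β * (Real.sin ((t + α) / 2) * Real.sin ((t - α) / 2))| /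
    (Real.sin ((t - α) / 2) ^ 2 * Real.sin (u + β) ^ 2 +
      Real.sin ((t + α) / 2) ^ 2 * Real.sin u ^ 2)

theorem limitSpeed_nonneg (α β t u : ℝ) : 0 ≤ limitSpeed α β t u := by
  unfold limitSpeed; positivity

theorem limitSpeed_periodic (α β t : ℝ) : Function.Periodic (limitSpeed α β t) Real.pi := by
  intro u
  unfold limitSpeed
  rw [show u + Real.pi + β = u + β + Real.pi by ring, Real.sin_add_pi, Real.sin_add_pi]
  simp

theorem sin_sq_le_two_mul (u β : ℝ) :
    Real.sin β ^ 2 ≤ 2 * (Real.sin (u + β) ^ 2 + Real.sin u ^ 2) := by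
  have h : Real.sin β = Real.sin (u + β) * Real.cos u - Real.cos (u + β) * Real.sin u := by
    rw [← Real.sin_sub]; ring_nf
  have h1 := Real.sin_sq_add_cos_sq u
  have h2 := Real.sin_sq_add_cos_sq (u + β)
  rw [h]
  nlinarith [sq_nonneg (Real.sin (u + β) * Real.cos u + Real.cos (u + β) * Real.sin u),
    sq_nonneg (Real.sin (u + β) * Real.sin u), sq_nonneg (Real.cos (u + β) * Real.sin u),
    mul_nonneg (sq_nonneg (Real.sin (u + β))) (sq_nonneg (Real.sin u)),
    mul_nonneg (sq_nonneg (Real.cos (u + β))) (sq_nonneg (Real.cos u))]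

/-- The sines of u and u + β cannot both be small when sin β is not, which bounds the denominator
below uniformly in the phase. -/
theorem le_quadratic {p q c : ℝ} (hp : c ≤ p ^ 2) (hq : c ≤ q ^ 2) (hc : 0 ≤ c) (u β : ℝ) :
    c * Real.sin β ^ 2 / 2 ≤ q ^ 2 * Real.sin (u + β) ^ 2 + p ^ 2 * Real.sin u ^ 2 := by
  have h1 := mul_le_mul_of_nonneg_right hq (sq_nonneg (Real.sin (u + β)))
  have h2 := mul_le_mul_of_nonneg_right hp (sq_nonneg (Real.sin u))
  have h3 := mul_le_mul_of_nonneg_left (sin_sq_le_two_mul u β) hc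
  linarith

theorem quadratic_pos {p q β : ℝ} (hp : p ≠ 0) (hq : q ≠ 0) (hβ : Real.sin β ≠ 0) (u : ℝ) :
    0 < q ^ 2 * Real.sin (u + β) ^ 2 + p ^ 2 * Real.sin u ^ 2 := by
  have hc : 0 < min (p ^ 2) (q ^ 2) := lt_min (by positivity) (by positivity)
  exact lt_of_lt_of_le (by positivity) (le_quadratic (min_le_left _ _) (min_le_right _ _) hc.le u β)

theorem continuous_limitSpeed {α β t : ℝ} (hβ : Real.sin β ≠ 0)
    (hp : Real.sin ((t + α) / 2) ≠ 0) (hq : Real.sin ((t - α) / 2) ≠ 0) :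
    Continuous (limitSpeed α β t) := by
  unfold limitSpeed
  exact Continuous.div (by fun_prop) (by fun_prop) fun u => (quadratic_pos hp hq hβ u).ne'

/-- The limiting speed performs exactly one half-turn per period. -/
theorem integral_limitSpeed {α β t : ℝ} (hβ : Real.sin β ≠ 0)
    (hp : Real.sin ((t + α) / 2) ≠ 0) (hq : Real.sin ((t - α) / 2) ≠ 0) :
    ∫ u in (0 : ℝ)..Real.pi, limitSpeed α β t u = Real.pi := by
  set p := Real.sin ((t + α) / 2) with hpdef
  set q := Real.sin ((t - α) / 2) with hqdef
  set κ := |q * Real.sin β / p| with hκ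
  have hκ0 : 0 < κ := abs_pos.2 (by positivity)
  have hκ2 : κ ^ 2 = (q * Real.sin β / p) ^ 2 := sq_abs _
  have hκ3 : |Real.sin β * (p * q)| = κ * p ^ 2 := by
    conv_rhs => rw [hκ, ← abs_of_nonneg (sq_nonneg p), ← abs_mul]
    congr 1
    field_simp
  -- Since sin(u+β)/(sin u sin β) = cot β + cot u, the speed is the derivative of -arctan H, and H
  -- falls from +∞ to -∞ on (0, π).
  set H : ℝ → ℝ := fun u => κ * (Real.cos β / Real.sin β + Real.cos u / Real.sin u) with hH
  have hderiv : ∀ u ∈ Ioo 0 Real.pi,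
      HasDerivAt (fun u => -Real.arctan (H u)) (limitSpeed α β t u) u := by
    intro u hu
    have hsu : Real.sin u ≠ 0 := (Real.sin_pos_of_pos_of_lt_pi hu.1 hu.2).ne'
    have h1 : HasDerivAt H (κ * ((-Real.sin u * Real.sin u - Real.cos u * Real.cos u) /
        Real.sin u ^ 2)) u :=
      (((Real.hasDerivAt_cos u).div (Real.hasDerivAt_sin u) hsu).const_add _).const_mul κ
    convert! h1.arctan.neg using 1
    have hs := Real.sin_sq_add_cos_sq u
    have hnum : -Real.sin u * Real.sin u - Real.cos u * Real.cos u = -1 := by linarith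
    have hHu : 1 + H u ^ 2 = (q ^ 2 * Real.sin (u + β) ^ 2 + p ^ 2 * Real.sin u ^ 2) /
        (p ^ 2 * Real.sin u ^ 2) := by
      simp only [hH]
      rw [mul_pow, hκ2, Real.sin_add]
      field_simp
      ring
    have hpos := quadratic_pos hp hq hβ u
    rw [hnum, hHu, limitSpeed, ← hpdef, ← hqdef, hκ3]
    field_simp
  have h0 : Tendsto (fun u => -Real.arctan (H u)) (𝓝[>] 0) (𝓝 (-(Real.pi / 2))) := by
    have hsin : Tendsto Real.sin (𝓝[>] 0) (𝓝[>] 0) := by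
      refine tendsto_nhdsWithin_iff.2 ⟨?_, ?_⟩
      · have := (Real.continuous_sin.tendsto 0).mono_left (nhdsWithin_le_nhds (s := Ioi 0))
        rwa [Real.sin_zero] at this
      · filter_upwards [Ioo_mem_nhdsGT Real.pi_pos] with u hu
        exact Real.sin_pos_of_pos_of_lt_pi hu.1 hu.2
    have hcos : Tendsto Real.cos (𝓝[>] 0) (𝓝 1) := by
      have := (Real.continuous_cos.tendsto 0).mono_left (nhdsWithin_le_nhds (s := Ioi 0))
      rwa [Real.cos_zero] at this
    have h1 : Tendsto (fun u => Real.cos u / Real.sin u) (𝓝[>] 0) atTop := by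
      simp_rw [div_eq_mul_inv]
      exact hcos.pos_mul_atTop one_pos (tendsto_inv_nhdsGT_zero.comp hsin)
    have h2 : Tendsto H (𝓝[>] 0) atTop :=
      (tendsto_atTop_add_const_left _ _ h1).const_mul_atTop hκ0
    exact ((Real.tendsto_arctan_atTop.mono_right nhdsWithin_le_nhds).comp h2).neg
  have hπ : Tendsto (fun u => -Real.arctan (H u)) (𝓝[<] Real.pi) (𝓝 (-(-(Real.pi / 2)))) := by
    have hsin : Tendsto Real.sin (𝓝[<] Real.pi) (𝓝[>] 0) := by
      refine tendsto_nhdsWithin_iff.2 ⟨?_, ?_⟩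
      · have := (Real.continuous_sin.tendsto Real.pi).mono_left
          (nhdsWithin_le_nhds (s := Iio Real.pi))
        rwa [Real.sin_pi] at this
      · filter_upwards [Ioo_mem_nhdsLT Real.pi_pos] with u hu
        exact Real.sin_pos_of_pos_of_lt_pi hu.1 hu.2
    have hcos : Tendsto Real.cos (𝓝[<] Real.pi) (𝓝 (-1)) := by
      have := (Real.continuous_cos.tendsto Real.pi).mono_left
        (nhdsWithin_le_nhds (s := Iio Real.pi))
      rwa [Real.cos_pi] at this
    have h1 : Tendsto (fun u => Real.cos u / Real.sin u) (𝓝[<] Real.pi) atBot := by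
      simp_rw [div_eq_mul_inv]
      exact hcos.neg_mul_atTop (by norm_num) (tendsto_inv_nhdsGT_zero.comp hsin)
    have h2 : Tendsto H (𝓝[<] Real.pi) atBot :=
      (tendsto_atBot_add_const_left _ _ h1).const_mul_atBot hκ0
    exact ((Real.tendsto_arctan_atBot.mono_right nhdsWithin_le_nhds).comp h2).neg
  rw [intervalIntegral.integral_eq_sub_of_hasDerivAt_of_tendsto Real.pi_pos hderiv
    ((continuous_limitSpeed hβ hp hq).intervalIntegrable _ _) h0 hπ]
  ring

theorem ae_sin_half_add_ne_zero (c : ℝ) : ∀ᵐ t : ℝ, Real.sin ((t + c) / 2) ≠ 0 := by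
  have h : {t : ℝ | Real.sin ((t + c) / 2) = 0}.Countable := by
    refine (countable_range fun k : ℤ => 2 * (k * Real.pi) - c).mono ?_
    intro t ht
    obtain ⟨k, hk⟩ := Real.sin_eq_zero_iff.1 ht
    exact ⟨k, by simp only [hk]; ring⟩
  filter_upwards [h.ae_notMem volume] with t ht using ht

theorem abs_sqrt_sub_sqrt_le (a b x y : ℝ) :
    |√(a ^ 2 + x ^ 2) - √(b ^ 2 + y ^ 2)| ≤ |a - b| + |x - y| := by
  have h1 : √(a ^ 2 + x ^ 2) = ‖(⟨a, x⟩ : ℂ)‖ := (Complex.norm_eq_sqrt_sq_add_sq ⟨a, x⟩).symm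
  have h2 : √(b ^ 2 + y ^ 2) = ‖(⟨b, y⟩ : ℂ)‖ := (Complex.norm_eq_sqrt_sq_add_sq ⟨b, y⟩).symm
  rw [h1, h2]
  have h3 := Complex.norm_le_abs_re_add_abs_im ((⟨a, x⟩ : ℂ) - ⟨b, y⟩)
  exact (abs_norm_sub_norm_le _ _).trans (by simpa using h3)

/-- Quotients with asymptotically equal data and denominators bounded below are asymptotically
equal. -/
theorem tendsto_abs_div_sub_abs_div {N D E : ℕ → ℝ} {N₀ c : ℝ} (hc : 0 < c)
    (hN : Tendsto N atTop (𝓝 N₀)) (hD : ∀ j, c ≤ D j)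
    (hE : Tendsto (fun j => E j - D j) atTop (𝓝 0)) :
    Tendsto (fun j => |N j / E j| - |N₀| / D j) atTop (𝓝 0) := by
  have hlow : ∀ᶠ j in atTop, c / 2 < E j := by
    filter_upwards [hE.eventually (lt_mem_nhds (by linarith : -(c / 2) < 0))] with j hj
    linarith [hD j]
  have hlim : Tendsto (fun j => abs (abs (N j) - abs N₀) * (2 / c) +
      abs N₀ * (abs (E j - D j) * (2 / c ^ 2)))
      atTop (𝓝 0) := by
    have h1 : Tendsto (fun j => abs (abs (N j) - abs N₀)) atTop (𝓝 0) := by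
      simpa using (hN.abs.sub_const |N₀|).abs
    have h2 : Tendsto (fun j => |E j - D j|) atTop (𝓝 0) := by simpa using hE.abs
    simpa using (h1.mul_const (2 / c)).add ((h2.mul_const (2 / c ^ 2)).const_mul |N₀|)
  refine squeeze_zero_norm' ?_ hlim
  filter_upwards [hlow] with j hj
  have hE0 : 0 < E j := lt_trans (by positivity) hj
  have hD0 : 0 < D j := lt_of_lt_of_le hc (hD j)
  have hEinv : (E j)⁻¹ ≤ 2 / c := by
    rw [inv_le_comm₀ hE0 (by positivity), inv_div]; exact hj.le
  have hEDinv : (E j * D j)⁻¹ ≤ 2 / c ^ 2 := by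
    rw [inv_le_comm₀ (by positivity) (by positivity), inv_div]
    nlinarith [hD j]
  have hid : |N j / E j| - |N₀| / D j =
      (|N j| - |N₀|) * (E j)⁻¹ + |N₀| * (-(E j - D j) * (E j * D j)⁻¹) := by
    rw [abs_div, abs_of_pos hE0]
    field_simp
    ring
  rw [Real.norm_eq_abs, hid]
  refine (abs_add_le _ _).trans (add_le_add ?_ ?_)
  · rw [abs_mul, abs_of_pos (inv_pos.2 hE0)]
    gcongr
  · rw [abs_mul, abs_abs, abs_mul, abs_neg, abs_of_pos (inv_pos.2 (mul_pos hE0 hD0))]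
    gcongr

section Limit

variable {α β : ℝ} {ν : ℕ → ℕ}

/-- Shifting t by 2u/n leaves the slow variables unchanged in the limit and advances the fast phase
by exactly u. The phase itself need not converge, so only the difference of the two speeds is shown
to vanish. -/
theorem tendsto_angularSpeed_sub_limitSpeed (hβ : Real.sin β ≠ 0) (hν : Tendsto ν atTop atTop)
    (hcos : Tendsto (fun j => Real.cos (ν j * α)) atTop (𝓝 (Real.cos β)))
    (hsin : Tendsto (fun j => Real.sin (ν j * α)) atTop (𝓝 (Real.sin β)))
    {t : ℝ} (hp : Real.sin ((t + α) / 2) ≠ 0) (hq : Real.sin ((t - α) / 2) ≠ 0) (u : ℝ) :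
    Tendsto (fun j => |2 / (ν j : ℝ) * angularSpeed α (ν j) (t + 2 * u / ν j)| -
      limitSpeed α β t (ν j * (t - α) / 2 + u)) atTop (𝓝 0) := by
  have hinv : Tendsto (fun j => ((ν j : ℝ))⁻¹) atTop (𝓝 0) :=
    tendsto_inv_atTop_zero.comp (tendsto_natCast_atTop_atTop.comp hν)
  have hshift : Tendsto (fun j => t + 2 * u / (ν j : ℝ)) atTop (𝓝 t) := by
    simpa [div_eq_mul_inv] using (hinv.const_mul (2 * u)).const_add t
  have hpj : Tendsto (fun j => Real.sin ((t + 2 * u / (ν j : ℝ) + α) / 2)) atTop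
      (𝓝 (Real.sin ((t + α) / 2))) :=
    (by fun_prop : Continuous fun s : ℝ => Real.sin ((s + α) / 2)).continuousAt.tendsto.comp hshift
  have hqj : Tendsto (fun j => Real.sin ((t + 2 * u / (ν j : ℝ) - α) / 2)) atTop
      (𝓝 (Real.sin ((t - α) / 2))) :=
    (by fun_prop : Continuous fun s : ℝ => Real.sin ((s - α) / 2)).continuousAt.tendsto.comp hshift
  set φ : ℕ → ℝ := fun j => ν j * (t - α) / 2 + u with hφ
  have hbdd : ∀ f : ℕ → ℝ, (∀ j, |f j| ≤ 1) → ∀ g : ℕ → ℝ, Tendsto g atTop (𝓝 0) →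
      Tendsto (fun j => g j * f j) atTop (𝓝 0) := fun f hf g hg =>
    squeeze_zero_norm (a := fun j => ‖g j‖) (fun j => by
      rw [norm_mul]
      exact mul_le_of_le_one_right (norm_nonneg _) (hf j)) (by simpa using hg.norm)
  have hN : Tendsto (fun j => Real.sin (ν j * α) *
      (Real.sin ((t + 2 * u / (ν j : ℝ) + α) / 2) * Real.sin ((t + 2 * u / (ν j : ℝ) - α) / 2)) -
      ((ν j : ℝ))⁻¹ * Real.sin α * (Real.sin (φ j + ν j * α) * Real.sin (φ j))) atTop
      (𝓝 (Real.sin β * (Real.sin ((t + α) / 2) * Real.sin ((t - α) / 2)))) := by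
    have h1 := hsin.mul (hpj.mul hqj)
    have h2 : Tendsto (fun j => ((ν j : ℝ))⁻¹ * Real.sin α *
        (Real.sin (φ j + ν j * α) * Real.sin (φ j))) atTop (𝓝 0) := by
      refine hbdd _ (fun j => ?_) _ (by simpa using hinv.mul_const (Real.sin α))
      rw [abs_mul]
      exact mul_le_one₀ (Real.abs_sin_le_one _) (abs_nonneg _) (Real.abs_sin_le_one _)
    simpa using h1.sub h2
  have hc : 0 < min (Real.sin ((t + α) / 2) ^ 2) (Real.sin ((t - α) / 2) ^ 2) *
      Real.sin β ^ 2 / 2 := by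
    have : 0 < min (Real.sin ((t + α) / 2) ^ 2) (Real.sin ((t - α) / 2) ^ 2) :=
      lt_min (by positivity) (by positivity)
    positivity
  have hD : ∀ j, min (Real.sin ((t + α) / 2) ^ 2) (Real.sin ((t - α) / 2) ^ 2) *
      Real.sin β ^ 2 / 2 ≤ Real.sin ((t - α) / 2) ^ 2 * Real.sin (φ j + β) ^ 2 +
        Real.sin ((t + α) / 2) ^ 2 * Real.sin (φ j) ^ 2 := fun j =>
    le_quadratic (min_le_left _ _) (min_le_right _ _) (by positivity) _ _
  have hsq : ∀ x : ℝ, |Real.sin x ^ 2| ≤ 1 := fun x => by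
    rw [abs_of_nonneg (sq_nonneg _)]; exact Real.sin_sq_le_one x
  have hE : Tendsto (fun j =>
      (Real.sin ((t + 2 * u / (ν j : ℝ) - α) / 2) ^ 2 * Real.sin (φ j + ν j * α) ^ 2 +
        Real.sin ((t + 2 * u / (ν j : ℝ) + α) / 2) ^ 2 * Real.sin (φ j) ^ 2) -
      (Real.sin ((t - α) / 2) ^ 2 * Real.sin (φ j + β) ^ 2 +
        Real.sin ((t + α) / 2) ^ 2 * Real.sin (φ j) ^ 2)) atTop (𝓝 0) := by
    have h1 : Tendsto (fun j => (Real.sin ((t + 2 * u / (ν j : ℝ) - α) / 2) ^ 2 -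
        Real.sin ((t - α) / 2) ^ 2) * Real.sin (φ j + ν j * α) ^ 2) atTop (𝓝 0) :=
      hbdd _ (fun j => hsq _) _ (tendsto_sub_nhds_zero_iff.2 (hqj.pow 2))
    have h2 : Tendsto (fun j => (Real.sin ((t + 2 * u / (ν j : ℝ) + α) / 2) ^ 2 -
        Real.sin ((t + α) / 2) ^ 2) * Real.sin (φ j) ^ 2) atTop (𝓝 0) :=
      hbdd _ (fun j => hsq _) _ (tendsto_sub_nhds_zero_iff.2 (hpj.pow 2))
    have h3 : Tendsto (fun j => (Real.cos (ν j * α) - Real.cos β) * Real.sin (φ j) +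
        (Real.sin (ν j * α) - Real.sin β) * Real.cos (φ j)) atTop (𝓝 (0 + 0)) :=
      (hbdd _ (fun j => Real.abs_sin_le_one _) _ (tendsto_sub_nhds_zero_iff.2 hcos)).add
        (hbdd _ (fun j => Real.abs_cos_le_one _) _ (tendsto_sub_nhds_zero_iff.2 hsin))
    -- Difference of two squared sines, factored; the 2 and the 1/2 only normalize the last factor
    -- to modulus at most 1.
    have h4 : Tendsto (fun j => ((Real.cos (ν j * α) - Real.cos β) * Real.sin (φ j) +
        (Real.sin (ν j * α) - Real.sin β) * Real.cos (φ j)) * (2 * Real.sin ((t - α) / 2) ^ 2) *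
        ((Real.sin (φ j + ν j * α) + Real.sin (φ j + β)) / 2)) atTop (𝓝 0) := by
      refine hbdd _ (fun j => ?_) _ (by simpa using h3.mul_const (2 * Real.sin ((t - α) / 2) ^ 2))
      rw [abs_le]
      have a1 := Real.sin_le_one (φ j + ν j * α)
      have a2 := Real.neg_one_le_sin (φ j + ν j * α)
      have a3 := Real.sin_le_one (φ j + β)
      have a4 := Real.neg_one_le_sin (φ j + β)
      constructor <;> linarith
    have h5 := (h1.add h2).add h4
    simp only [add_zero] at h5
    refine h5.congr fun j => ?_
    have e1 := Real.sin_add (φ j) (ν j * α)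
    have e2 := Real.sin_add (φ j) β
    have e3 : (Real.cos (ν j * α) - Real.cos β) * Real.sin (φ j) +
        (Real.sin (ν j * α) - Real.sin β) * Real.cos (φ j) =
        Real.sin (φ j + ν j * α) - Real.sin (φ j + β) := by rw [e1, e2]; ring
    rw [e3]
    ring
  have key := tendsto_abs_div_sub_abs_div hc hN hD hE
  refine key.congr' ?_
  filter_upwards [hν.eventually_ge_atTop 1, hpj.eventually_ne hp, hqj.eventually_ne hq]
    with j hj h1 h2
  have hj0 : (ν j : ℝ) ≠ 0 := by positivity
  have hphase : (ν j : ℝ) * (t + 2 * u / (ν j : ℝ) - α) / 2 = φ j := by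
    simp only [hφ]; field_simp; ring
  rw [angularSpeed_eq hj h1 h2, hphase]
  rfl

end Limit

/-! ### Averaging over the fast phase. -/

/-- Lebesgue measure on the rectangle of slow times and fast phases. -/
noncomputable def phaseMeasure : Measure (ℝ × ℝ) :=
  (volume.restrict (Ioc 0 (2 * Real.pi))).prod (volume.restrict (Ioc 0 Real.pi))

instance : IsFiniteMeasure phaseMeasure := by unfold phaseMeasure; infer_instance

/-- The limit of the normalized expected number of zeros along indices `n` such that `n α` tends
to `β` modulo `2 π`. -/
noncomputable def limitZeros (α β : ℝ) : ℝ :=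
  1 / (2 * Real.pi ^ 2) * ∫ t in (0 : ℝ)..2 * Real.pi, ∫ u in (0 : ℝ)..Real.pi,
    √(1 + limitSpeed α β t u ^ 2)

theorem Continuous.integrable_phaseMeasure {f : ℝ × ℝ → ℝ} (hf : Continuous f) :
    Integrable f phaseMeasure := by
  rw [phaseMeasure, Measure.prod_restrict, ← Measure.volume_eq_prod]
  exact (hf.continuousOn.integrableOn_compact (isCompact_Icc.prod isCompact_Icc)).mono_set
    (Set.prod_mono Ioc_subset_Icc_self Ioc_subset_Icc_self)

/-- By periodicity the shift costs nothing. With c = 2/n this introduces the fast phase as an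
independent variable. -/
theorem integral_phaseMeasure_shift {f : ℝ → ℝ} (hf : Continuous f)
    (hper : Function.Periodic f (2 * Real.pi)) (c : ℝ) :
    ∫ p, f (p.1 + c * p.2) ∂phaseMeasure = Real.pi * ∫ t in (0 : ℝ)..2 * Real.pi, f t := by
  have hint : Integrable (fun p : ℝ × ℝ => f (p.1 + c * p.2)) phaseMeasure :=
    Continuous.integrable_phaseMeasure (by fun_prop)
  rw [phaseMeasure] at hint ⊢
  rw [integral_prod_symm _ hint]
  have hin : ∀ u : ℝ, ∫ t in Ioc 0 (2 * Real.pi), f (t + c * u) =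
      ∫ t in (0 : ℝ)..2 * Real.pi, f t := by
    intro u
    rw [← intervalIntegral.integral_of_le (by positivity),
      intervalIntegral.integral_comp_add_right f, zero_add, add_comm (2 * Real.pi)]
    have := hper.intervalIntegral_add_eq (c * u) 0
    rwa [zero_add] at this
  simp only [hin]
  simp [Real.pi_pos.le]

theorem measurable_limitSpeed (α β : ℝ) {c : ℝ → ℝ} (hc : Measurable c) :
    Measurable fun p : ℝ × ℝ => limitSpeed α β p.1 (c p.1 + p.2) := by
  unfold limitSpeed; fun_prop

theorem integral_limitSpeed_shift {α β t : ℝ} (F : ℝ → ℝ) (s : ℝ) :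
    ∫ u in Ioc 0 Real.pi, F (limitSpeed α β t (s + u)) =
      ∫ u in (0 : ℝ)..Real.pi, F (limitSpeed α β t u) := by
  rw [← intervalIntegral.integral_of_le Real.pi_pos.le,
    intervalIntegral.integral_comp_add_left (fun u => F (limitSpeed α β t u)), add_zero]
  have hper : Function.Periodic (fun u => F (limitSpeed α β t u)) Real.pi := fun u => by
    simp only [limitSpeed_periodic α β t u]
  have := hper.intervalIntegral_add_eq s 0
  rwa [zero_add] at this

theorem ae_good (α : ℝ) : ∀ᵐ t ∂(volume.restrict (Ioc 0 (2 * Real.pi))),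
    Real.sin ((t + α) / 2) ≠ 0 ∧ Real.sin ((t - α) / 2) ≠ 0 := by
  refine ae_restrict_of_ae ?_
  filter_upwards [ae_sin_half_add_ne_zero α, ae_sin_half_add_ne_zero (-α)] with t h1 h2
  exact ⟨h1, by rwa [sub_eq_add_neg]⟩

section Phase

variable {α β : ℝ} {c : ℝ → ℝ}

/-- The speed may be unbounded near the zeros of sin((t±α)/2), but its integral over one phase
period is π for almost every t. -/
theorem integrable_limitSpeed (hβ : Real.sin β ≠ 0) (hc : Measurable c) :
    Integrable (fun p : ℝ × ℝ => limitSpeed α β p.1 (c p.1 + p.2)) phaseMeasure := by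
  rw [phaseMeasure, integrable_prod_iff (measurable_limitSpeed α β hc).aestronglyMeasurable]
  constructor
  · filter_upwards [ae_good α] with t ht
    exact ((continuous_limitSpeed hβ ht.1 ht.2).comp (by fun_prop)).integrableOn_Ioc
  · refine (integrable_const Real.pi).congr ?_
    filter_upwards [ae_good α] with t ht
    simp only [Real.norm_eq_abs]
    rw [integral_limitSpeed_shift (fun x => |x|)]
    simp only [abs_of_nonneg (limitSpeed_nonneg _ _ _ _)]
    exact (integral_limitSpeed hβ ht.1 ht.2).symm

theorem integral_limitSpeed_phaseMeasure (hβ : Real.sin β ≠ 0) (hc : Measurable c) :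
    ∫ p, limitSpeed α β p.1 (c p.1 + p.2) ∂phaseMeasure = 2 * Real.pi ^ 2 := by
  have hint := integrable_limitSpeed (α := α) hβ hc
  rw [phaseMeasure] at hint ⊢
  rw [integral_prod _ hint]
  have : ∀ᵐ t ∂(volume.restrict (Ioc 0 (2 * Real.pi))),
      ∫ u in Ioc 0 Real.pi, limitSpeed α β t (c t + u) = Real.pi := by
    filter_upwards [ae_good α] with t ht
    rw [integral_limitSpeed_shift (fun x => x), integral_limitSpeed hβ ht.1 ht.2]
  rw [integral_congr_ae this]
  simp [Real.pi_pos.le]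
  ring

theorem integrable_sqrt_limitSpeed (hβ : Real.sin β ≠ 0) (hc : Measurable c) :
    Integrable (fun p : ℝ × ℝ => √(1 + limitSpeed α β p.1 (c p.1 + p.2) ^ 2)) phaseMeasure := by
  refine Integrable.mono' ((integrable_const 1).add (integrable_limitSpeed (α := α) hβ hc))
    (((measurable_limitSpeed α β hc).pow_const 2).const_add 1).sqrt.aestronglyMeasurable ?_
  refine Filter.Eventually.of_forall fun p => ?_
  have h0 := limitSpeed_nonneg α β p.1 (c p.1 + p.2)
  rw [Real.norm_eq_abs, abs_of_nonneg (Real.sqrt_nonneg _)]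
  simp only [Pi.add_apply]
  exact Real.sqrt_le_iff.2 ⟨by linarith, by nlinarith⟩

theorem integral_sqrt_limitSpeed (hβ : Real.sin β ≠ 0) (hc : Measurable c) :
    1 / (2 * Real.pi ^ 2) * ∫ p, √(1 + limitSpeed α β p.1 (c p.1 + p.2) ^ 2) ∂phaseMeasure =
      limitZeros α β := by
  have hint := integrable_sqrt_limitSpeed (α := α) hβ hc
  rw [phaseMeasure] at hint ⊢
  rw [integral_prod _ hint, limitZeros, intervalIntegral.integral_of_le (by positivity)]
  congr 1
  refine integral_congr_ae (Filter.Eventually.of_forall fun t => ?_)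
  exact integral_limitSpeed_shift (fun x => √(1 + x ^ 2)) (c t)

end Phase

section Limit

variable {α β : ℝ} {ν : ℕ → ℕ}

/-- This positive part is dominated by the limiting speed. Dominated convergence is applied twice:
in u with a bound depending on t, then in t with the constant π. -/
theorem tendsto_integral_posPart (hβ : Real.sin β ≠ 0) (hν : Tendsto ν atTop atTop)
    (hcos : Tendsto (fun j => Real.cos (ν j * α)) atTop (𝓝 (Real.cos β)))
    (hsin : Tendsto (fun j => Real.sin (ν j * α)) atTop (𝓝 (Real.sin β)))
    (hne : ∀ j, Real.sin (ν j * α) ≠ 0) :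
    Tendsto (fun j => ∫ p, max (limitSpeed α β p.1 (ν j * (p.1 - α) / 2 + p.2) -
      |2 / (ν j : ℝ) * angularSpeed α (ν j) (p.1 + 2 / ν j * p.2)|) 0 ∂phaseMeasure)
      atTop (𝓝 0) := by
  have hρ : ∀ j, Integrable (fun p : ℝ × ℝ => limitSpeed α β p.1 (ν j * (p.1 - α) / 2 + p.2))
      phaseMeasure := fun j =>
    integrable_limitSpeed (c := fun t => ν j * (t - α) / 2) hβ (by fun_prop)
  have hA : ∀ j, Continuous (angularSpeed α (ν j)) := fun j => continuous_angularSpeed (hne j)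
  have hR : ∀ j, Continuous fun p : ℝ × ℝ =>
      |2 / (ν j : ℝ) * angularSpeed α (ν j) (p.1 + 2 / ν j * p.2)| := fun j => by
    have := hA j; fun_prop
  have hT : ∀ j, Integrable (fun p : ℝ × ℝ => max (limitSpeed α β p.1 (ν j * (p.1 - α) / 2 + p.2) -
      |2 / (ν j : ℝ) * angularSpeed α (ν j) (p.1 + 2 / ν j * p.2)|) 0) phaseMeasure := fun j =>
    ((hρ j).sub (Continuous.integrable_phaseMeasure (hR j))).pos_part
  have hle : ∀ (j : ℕ) (p : ℝ × ℝ), max (limitSpeed α β p.1 (ν j * (p.1 - α) / 2 + p.2) -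
      |2 / (ν j : ℝ) * angularSpeed α (ν j) (p.1 + 2 / ν j * p.2)|) 0 ≤
      limitSpeed α β p.1 (ν j * (p.1 - α) / 2 + p.2) := fun j p =>
    max_le (sub_le_self _ (abs_nonneg _)) (limitSpeed_nonneg _ _ _ _)
  simp only [phaseMeasure] at hT ⊢
  simp_rw [fun j => integral_prod _ (hT j)]
  rw [show 𝓝 (0 : ℝ) = 𝓝 (∫ _ in Ioc 0 (2 * Real.pi), (0 : ℝ)) by simp]
  refine tendsto_integral_of_dominated_convergence (fun _ => Real.pi)
    (fun j => (hT j).integral_prod_left.aestronglyMeasurable) (integrable_const _) ?_ ?_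
  · intro j
    filter_upwards [ae_good α] with t ht
    have hi : IntegrableOn (fun u => limitSpeed α β t (ν j * (t - α) / 2 + u))
        (Ioc 0 Real.pi) :=
      ((continuous_limitSpeed hβ ht.1 ht.2).comp (by fun_prop)).integrableOn_Ioc
    have hmax : Continuous fun u => max (limitSpeed α β t (ν j * (t - α) / 2 + u) -
        |2 / (ν j : ℝ) * angularSpeed α (ν j) (t + 2 / ν j * u)|) 0 := by
      have h1 := continuous_limitSpeed hβ ht.1 ht.2
      have h2 := hA j
      fun_prop
    rw [Real.norm_eq_abs, abs_of_nonneg (integral_nonneg fun u => le_max_right _ _)]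
    refine (integral_mono hmax.integrableOn_Ioc hi fun u => hle j (t, u)).trans ?_
    rw [integral_limitSpeed_shift (fun x => x), integral_limitSpeed hβ ht.1 ht.2]
  · filter_upwards [ae_good α] with t ht
    rw [show 𝓝 (0 : ℝ) = 𝓝 (∫ _ in Ioc 0 Real.pi, (0 : ℝ)) by simp]
    have hc : 0 < min (Real.sin ((t + α) / 2) ^ 2) (Real.sin ((t - α) / 2) ^ 2) *
        Real.sin β ^ 2 / 2 := by
      have h1 := ht.1
      have h2 := ht.2
      have : 0 < min (Real.sin ((t + α) / 2) ^ 2) (Real.sin ((t - α) / 2) ^ 2) :=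
        lt_min (by positivity) (by positivity)
      positivity
    refine tendsto_integral_of_dominated_convergence
      (fun _ => |Real.sin β * (Real.sin ((t + α) / 2) * Real.sin ((t - α) / 2))| /
        (min (Real.sin ((t + α) / 2) ^ 2) (Real.sin ((t - α) / 2) ^ 2) * Real.sin β ^ 2 / 2))
      ?_ (integrable_const _) ?_ ?_
    · intro j
      have h1 := continuous_limitSpeed hβ ht.1 ht.2
      have h2 := hA j
      exact Continuous.aestronglyMeasurable (by fun_prop)
    · intro j
      refine Filter.Eventually.of_forall fun u => ?_
      rw [Real.norm_eq_abs, abs_of_nonneg (le_max_right _ _)]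
      refine (hle j (t, u)).trans ?_
      unfold limitSpeed
      exact div_le_div_of_nonneg_left (abs_nonneg _) hc
        (le_quadratic (min_le_left _ _) (min_le_right _ _) (by positivity) _ _)
    · refine Filter.Eventually.of_forall fun u => ?_
      have := (tendsto_angularSpeed_sub_limitSpeed hβ hν hcos hsin ht.1 ht.2 u).neg.max
        (tendsto_const_nhds (x := (0 : ℝ)))
      simp only [neg_zero, max_self, neg_sub] at this
      refine this.congr fun j => ?_
      rw [show 2 * u / (ν j : ℝ) = 2 / ν j * u by ring]

/-- Scheffé's argument with R the actual and ρ the limiting speed: |R-ρ| = R - ρ + 2(ρ-R)⁺, where ∫R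
≤ 2π² = ∫ρ and the positive part tends to zero in mean. -/
theorem tendsto_normalizedZeros (hβ : Real.sin β ≠ 0) (hν : Tendsto ν atTop atTop)
    (hν1 : ∀ j, 1 ≤ ν j)
    (hcos : Tendsto (fun j => Real.cos (ν j * α)) atTop (𝓝 (Real.cos β)))
    (hsin : Tendsto (fun j => Real.sin (ν j * α)) atTop (𝓝 (Real.sin β)))
    (hne : ∀ j, Real.sin (ν j * α) ≠ 0) :
    Tendsto (fun j => normalizedZeros α (ν j)) atTop (𝓝 (limitZeros α β)) := by
  have hinv : Tendsto (fun j => ((ν j : ℝ))⁻¹) atTop (𝓝 0) :=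
    tendsto_inv_atTop_zero.comp (tendsto_natCast_atTop_atTop.comp hν)
  have hpos := tendsto_integral_posPart hβ hν hcos hsin hne
  have hbound : Tendsto (fun j => ((ν j : ℝ))⁻¹ + 1 / Real.pi ^ 2 *
      ∫ p, max (limitSpeed α β p.1 (ν j * (p.1 - α) / 2 + p.2) -
      |2 / (ν j : ℝ) * angularSpeed α (ν j) (p.1 + 2 / ν j * p.2)|) 0 ∂phaseMeasure)
      atTop (𝓝 0) := by
    have := hinv.add (hpos.const_mul (1 / Real.pi ^ 2))
    rwa [mul_zero, add_zero] at this
  refine tendsto_sub_nhds_zero_iff.1 (squeeze_zero_norm (fun j => ?_) hbound)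
  set n := ν j with hn
  have hn0 : (0 : ℝ) < n := by exact_mod_cast hν1 j
  have hA := continuous_angularSpeed (hne j)
  set ρ : ℝ × ℝ → ℝ := fun p => limitSpeed α β p.1 (n * (p.1 - α) / 2 + p.2) with hρdef
  set R : ℝ × ℝ → ℝ := fun p => |2 / (n : ℝ) * angularSpeed α n (p.1 + 2 / n * p.2)| with hRdef
  have hRc : Continuous R := by fun_prop
  have hρi : Integrable ρ phaseMeasure :=
    integrable_limitSpeed (c := fun t => n * (t - α) / 2) hβ (by fun_prop)
  have hRi : Integrable R phaseMeasure := Continuous.integrable_phaseMeasure hRc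
  have hρint : ∫ p, ρ p ∂phaseMeasure = 2 * Real.pi ^ 2 :=
    integral_limitSpeed_phaseMeasure (c := fun t => n * (t - α) / 2) hβ (by fun_prop)
  have hRint : ∫ p, R p ∂phaseMeasure ≤ 2 * Real.pi ^ 2 := by
    have h1 : ∫ p, R p ∂phaseMeasure = Real.pi * ∫ t in (0 : ℝ)..2 * Real.pi,
        |2 / (n : ℝ) * angularSpeed α n t| :=
      integral_phaseMeasure_shift (f := fun t => |2 / (n : ℝ) * angularSpeed α n t|)
        (by fun_prop) (fun t => by simp only [angularSpeed_periodic α n t]) (2 / n)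
    have h2 : ∫ t in (0 : ℝ)..2 * Real.pi, |angularSpeed α n t| ≤ n * Real.pi := by
      rw [intervalIntegral.integral_of_le (by positivity), ← integral_Icc_eq_integral_Ioc,
        ← ENNReal.ofReal_le_ofReal_iff (by positivity), ofReal_integral_eq_lintegral_ofReal]
      · exact lintegral_abs_angularSpeed_le (hν1 j) (hne j)
      · exact hA.abs.integrableOn_Icc
      · exact Filter.Eventually.of_forall fun t => abs_nonneg _
    rw [h1]
    simp_rw [abs_mul]
    rw [intervalIntegral.integral_const_mul, abs_of_pos (by positivity : (0 : ℝ) < 2 / n)]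
    calc Real.pi * (2 / n * ∫ t in (0 : ℝ)..2 * Real.pi, |angularSpeed α n t|)
        ≤ Real.pi * (2 / n * (n * Real.pi)) := by gcongr
      _ = 2 * Real.pi ^ 2 := by field_simp
  have hmaxi : Integrable (fun p => max (ρ p - R p) 0) phaseMeasure := (hρi.sub hRi).pos_part
  have hnorm : normalizedZeros α n = 1 / (2 * Real.pi ^ 2) *
      ∫ p, √((1 + (n : ℝ)⁻¹) ^ 2 + R p ^ 2) ∂phaseMeasure := by
    have h1 := integral_phaseMeasure_shift
      (f := fun t => √((1 + (n : ℝ)⁻¹) ^ 2 + (2 / n * angularSpeed α n t) ^ 2))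
      (by fun_prop) (fun t => by simp only [angularSpeed_periodic α n t]) (2 / n)
    simp only [hRdef, sq_abs]
    rw [h1, normalizedZeros]
    have := Real.pi_pos
    field_simp
  have hlimit : limitZeros α β = 1 / (2 * Real.pi ^ 2) * ∫ p, √(1 + ρ p ^ 2) ∂phaseMeasure :=
    (integral_sqrt_limitSpeed (c := fun t => n * (t - α) / 2) hβ (by fun_prop)).symm
  have hsqR : Integrable (fun p => √((1 + (n : ℝ)⁻¹) ^ 2 + R p ^ 2)) phaseMeasure :=
    Continuous.integrable_phaseMeasure (by fun_prop)
  have hsqρ : Integrable (fun p => √(1 + ρ p ^ 2)) phaseMeasure :=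
    integrable_sqrt_limitSpeed (c := fun t => n * (t - α) / 2) hβ (by fun_prop)
  have hmass : phaseMeasure.real univ = 2 * Real.pi ^ 2 := by
    simp [phaseMeasure, Measure.real, ← univ_prod_univ, Measure.prod_prod, Real.pi_pos.le,
      ENNReal.toReal_mul]
    ring
  rw [hnorm, hlimit, ← mul_sub, ← integral_sub hsqR hsqρ, Real.norm_eq_abs, abs_mul,
    abs_of_pos (by positivity : (0 : ℝ) < 1 / (2 * Real.pi ^ 2))]
  have hptw : ∀ p, |√((1 + (n : ℝ)⁻¹) ^ 2 + R p ^ 2) - √(1 + ρ p ^ 2)| ≤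
      (n : ℝ)⁻¹ + (R p - ρ p + 2 * max (ρ p - R p) 0) := by
    intro p
    have h1 := abs_sqrt_sub_sqrt_le (1 + (n : ℝ)⁻¹) 1 (R p) (ρ p)
    rw [one_pow, add_sub_cancel_left, abs_of_pos (inv_pos.2 hn0)] at h1
    refine h1.trans (add_le_add_right ?_ _)
    rcases le_total (ρ p) (R p) with h | h
    · rw [max_eq_right (by linarith), abs_of_nonneg (by linarith)]; linarith
    · rw [max_eq_left (by linarith), abs_of_nonpos (by linarith)]; linarith
  have hdiff : Integrable (fun p => R p - ρ p) phaseMeasure := hRi.sub hρi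
  have hmaxi' : Integrable (fun p => 2 * max (ρ p - R p) 0) phaseMeasure := hmaxi.const_mul 2
  have hsum : Integrable (fun p => R p - ρ p + 2 * max (ρ p - R p) 0) phaseMeasure :=
    hdiff.add hmaxi'
  have hfinal : |∫ p, (√((1 + (n : ℝ)⁻¹) ^ 2 + R p ^ 2) - √(1 + ρ p ^ 2)) ∂phaseMeasure| ≤
      2 * Real.pi ^ 2 * (n : ℝ)⁻¹ + 2 * ∫ p, max (ρ p - R p) 0 ∂phaseMeasure := by
    calc _ ≤ ∫ p, |√((1 + (n : ℝ)⁻¹) ^ 2 + R p ^ 2) - √(1 + ρ p ^ 2)| ∂phaseMeasure :=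
          abs_integral_le_integral_abs
      _ ≤ ∫ p, ((n : ℝ)⁻¹ + (R p - ρ p + 2 * max (ρ p - R p) 0)) ∂phaseMeasure :=
          integral_mono (hsqR.sub hsqρ).abs
            ((integrable_const _).add hsum) hptw
      _ = 2 * Real.pi ^ 2 * (n : ℝ)⁻¹ + (∫ p, R p ∂phaseMeasure - ∫ p, ρ p ∂phaseMeasure +
            2 * ∫ p, max (ρ p - R p) 0 ∂phaseMeasure) := by
          rw [integral_add (integrable_const _) hsum, integral_add hdiff hmaxi',
            integral_sub hRi hρi,
            integral_const_mul, integral_const, hmass, smul_eq_mul]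
      _ ≤ _ := by rw [hρint]; linarith
  calc _ ≤ 1 / (2 * Real.pi ^ 2) * (2 * Real.pi ^ 2 * (n : ℝ)⁻¹ +
        2 * ∫ p, max (ρ p - R p) 0 ∂phaseMeasure) := by gcongr
    _ = (n : ℝ)⁻¹ + 1 / Real.pi ^ 2 * ∫ p, max (ρ p - R p) 0 ∂phaseMeasure := by
        have := Real.pi_pos
        field_simp

end Limit

/-! ### Range of the limiting zero density. -/

theorem sqrt_one_add_sq_le {x : ℝ} (hx : 0 ≤ x) : √(1 + x ^ 2) ≤ 1 + x :=
  Real.sqrt_le_iff.2 ⟨by linarith, by nlinarith⟩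

theorem continuous_sqrt_limitSpeed {α β t : ℝ} (hβ : Real.sin β ≠ 0)
    (hp : Real.sin ((t + α) / 2) ≠ 0) (hq : Real.sin ((t - α) / 2) ≠ 0) :
    Continuous fun u => √(1 + limitSpeed α β t u ^ 2) := by
  have := continuous_limitSpeed hβ hp hq
  fun_prop

theorem integral_sqrt_limitSpeed_le {α β t : ℝ} (hβ : Real.sin β ≠ 0)
    (hp : Real.sin ((t + α) / 2) ≠ 0) (hq : Real.sin ((t - α) / 2) ≠ 0) :
    ∫ u in (0 : ℝ)..Real.pi, √(1 + limitSpeed α β t u ^ 2) ≤ 2 * Real.pi := by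
  have h1 := continuous_limitSpeed hβ hp hq
  calc _ ≤ ∫ u in (0 : ℝ)..Real.pi, (1 + limitSpeed α β t u) :=
        intervalIntegral.integral_mono_on Real.pi_pos.le
          ((continuous_sqrt_limitSpeed hβ hp hq).intervalIntegrable _ _)
          ((continuous_const.add h1).intervalIntegrable _ _)
          fun u _ => sqrt_one_add_sq_le (limitSpeed_nonneg _ _ _ _)
    _ = 2 * Real.pi := by
        rw [intervalIntegral.integral_add (by simp) (h1.intervalIntegrable _ _),
          integral_limitSpeed hβ hp hq]
        simp
        ring

/-- The phase integrals are at most 2π whatever the parameters, so convergence for almost every t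
suffices. -/
theorem tendsto_limitZeros {ι : Type*} {l : Filter ι} [l.IsCountablyGenerated] {a b : ι → ℝ}
    {G : ℝ → ℝ} (hb : ∀ᶠ i in l, Real.sin (b i) ≠ 0)
    (h : ∀ᵐ t ∂(volume.restrict (Ioc 0 (2 * Real.pi))),
      Tendsto (fun i => ∫ u in (0 : ℝ)..Real.pi, √(1 + limitSpeed (a i) (b i) t u ^ 2)) l
        (𝓝 (G t))) :
    Tendsto (fun i => limitZeros (a i) (b i)) l
      (𝓝 (1 / (2 * Real.pi ^ 2) * ∫ t in (0 : ℝ)..2 * Real.pi, G t)) := by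
  refine Tendsto.const_mul _ ?_
  simp_rw [intervalIntegral.integral_of_le (by positivity : (0 : ℝ) ≤ 2 * Real.pi)]
  refine tendsto_integral_filter_of_dominated_convergence (fun _ => 2 * Real.pi) ?_ ?_
    (integrable_const _) h
  · filter_upwards [hb] with i hi
    have := integrable_sqrt_limitSpeed (α := a i) (c := fun _ => 0) hi (by fun_prop)
    simp only [zero_add, phaseMeasure] at this
    simp_rw [intervalIntegral.integral_of_le Real.pi_pos.le]
    exact this.integral_prod_left.aestronglyMeasurable
  · filter_upwards [hb] with i hi
    filter_upwards [ae_good (a i)] with t ht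
    rw [Real.norm_eq_abs, abs_of_nonneg (intervalIntegral.integral_nonneg Real.pi_pos.le
      fun u _ => Real.sqrt_nonneg _)]
    exact integral_sqrt_limitSpeed_le hi ht.1 ht.2

theorem continuousAt_limitZeros {α β : ℝ} (hβ : Real.sin β ≠ 0) :
    ContinuousAt (fun x : ℝ × ℝ => limitZeros x.1 x.2) (α, β) := by
  have hsin : Tendsto (fun x : ℝ × ℝ => Real.sin x.2) (𝓝 (α, β)) (𝓝 (Real.sin β)) :=
    (by fun_prop : Continuous fun x : ℝ × ℝ => Real.sin x.2).tendsto (α, β)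
  refine tendsto_limitZeros (hsin.eventually_ne hβ) ?_
  filter_upwards [ae_good α] with t ht
  obtain ⟨hp, hq⟩ := ht
  have hp' : Tendsto (fun x : ℝ × ℝ => Real.sin ((t + x.1) / 2) ^ 2) (𝓝 (α, β))
      (𝓝 (Real.sin ((t + α) / 2) ^ 2)) :=
    (by fun_prop : Continuous fun x : ℝ × ℝ => Real.sin ((t + x.1) / 2) ^ 2).tendsto (α, β)
  have hq' : Tendsto (fun x : ℝ × ℝ => Real.sin ((t - x.1) / 2) ^ 2) (𝓝 (α, β))
      (𝓝 (Real.sin ((t - α) / 2) ^ 2)) :=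
    (by fun_prop : Continuous fun x : ℝ × ℝ => Real.sin ((t - x.1) / 2) ^ 2).tendsto (α, β)
  set p := Real.sin ((t + α) / 2) with hpdef
  set q := Real.sin ((t - α) / 2) with hqdef
  set c := min (p ^ 2) (q ^ 2) / 2 with hcdef
  have hc : 0 < c := by
    have : 0 < min (p ^ 2) (q ^ 2) := lt_min (by positivity) (by positivity)
    positivity
  have hcp : c < p ^ 2 := by
    have := min_le_left (p ^ 2) (q ^ 2); linarith
  have hcq : c < q ^ 2 := by
    have := min_le_right (p ^ 2) (q ^ 2); linarith
  have hs : Real.sin β ^ 2 / 2 < Real.sin β ^ 2 := half_lt_self (by positivity)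
  have hden : 0 < c * (Real.sin β ^ 2 / 2) / 2 := by positivity
  refine intervalIntegral.tendsto_integral_filter_of_dominated_convergence
    (fun _ => 1 + 1 / (c * (Real.sin β ^ 2 / 2) / 2)) ?_ ?_ (by simp) ?_
  · filter_upwards [hsin.eventually_ne hβ, hp'.eventually_ne (pow_ne_zero 2 hp),
      hq'.eventually_ne (pow_ne_zero 2 hq)] with x h1 h2 h3
    exact (continuous_sqrt_limitSpeed h1 (ne_zero_pow two_ne_zero h2)
      (ne_zero_pow two_ne_zero h3)).aestronglyMeasurable
  · filter_upwards [(hsin.pow 2).eventually (lt_mem_nhds hs), hp'.eventually (lt_mem_nhds hcp),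
      hq'.eventually (lt_mem_nhds hcq)] with x h1 h2 h3
    refine Filter.Eventually.of_forall fun u _ => ?_
    rw [Real.norm_eq_abs, abs_of_nonneg (Real.sqrt_nonneg _)]
    refine (sqrt_one_add_sq_le (limitSpeed_nonneg _ _ _ _)).trans (add_le_add_right ?_ 1)
    unfold limitSpeed
    refine div_le_div₀ zero_le_one ?_ hden (le_trans ?_ (le_quadratic h2.le h3.le hc.le u x.2))
    · rw [abs_mul, abs_mul]
      exact mul_le_one₀ (Real.abs_sin_le_one _) (by positivity)
        (mul_le_one₀ (Real.abs_sin_le_one _) (abs_nonneg _) (Real.abs_sin_le_one _))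
    · gcongr
  · refine Filter.Eventually.of_forall fun u _ => ?_
    have : ContinuousAt (fun x : ℝ × ℝ => limitSpeed x.1 x.2 t u) (α, β) := by
      unfold limitSpeed
      exact ContinuousAt.div (by fun_prop) (by fun_prop) (quadratic_pos hp hq hβ u).ne'
    exact ((this.pow 2).const_add 1).sqrt

/-- As β → 0+ the speed tends to zero at interior phases but keeps its mass π, so it concentrates
where √(1+x²) is close to 1 + x, and the phase integral tends to π + π. -/
theorem tendsto_limitZeros_nhdsGT_zero (α : ℝ) :
    Tendsto (limitZeros α) (𝓝[>] 0) (𝓝 2) := by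
  have hpos : ∀ᶠ β in 𝓝[>] (0 : ℝ), Real.sin β ≠ 0 := by
    filter_upwards [Ioo_mem_nhdsGT Real.pi_pos] with u hu
    exact (Real.sin_pos_of_pos_of_lt_pi hu.1 hu.2).ne'
  have key := tendsto_limitZeros (a := fun _ => α) (b := id) (G := fun _ => 2 * Real.pi) hpos ?_
  · convert! key using 2
    simp only [intervalIntegral.integral_const, smul_eq_mul]
    have := Real.pi_pos
    field_simp
    ring
  filter_upwards [ae_good α] with t ht
  obtain ⟨hp, hq⟩ := ht
  -- Unlike the speed, the defect 1 + x - √(1+x²) lies in [0, 1], so dominated convergence applies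
  -- despite the concentration.
  have hdefect : Tendsto (fun β => ∫ u in (0 : ℝ)..Real.pi,
      (1 + limitSpeed α β t u - √(1 + limitSpeed α β t u ^ 2))) (𝓝[>] 0)
      (𝓝 (∫ _ in (0 : ℝ)..Real.pi, (0 : ℝ))) := by
    refine intervalIntegral.tendsto_integral_filter_of_dominated_convergence (fun _ => 1)
      ?_ ?_ (by simp) ?_
    · filter_upwards [hpos] with β hβ
      exact ((continuous_const.add (continuous_limitSpeed hβ hp hq)).sub
        (continuous_sqrt_limitSpeed hβ hp hq)).aestronglyMeasurable
    · refine Filter.Eventually.of_forall fun β => Filter.Eventually.of_forall fun u _ => ?_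
      have h0 := limitSpeed_nonneg α β t u
      have h1 := sqrt_one_add_sq_le h0
      have h2 : limitSpeed α β t u ≤ √(1 + limitSpeed α β t u ^ 2) :=
        Real.le_sqrt_of_sq_le (by linarith)
      rw [Real.norm_eq_abs, abs_of_nonneg (by linarith)]
      linarith
    · have hnull : ∀ᵐ u : ℝ, u ≠ Real.pi := by simp [ae_iff]
      filter_upwards [hnull] with u hu1 hu
      rw [uIoc_of_le Real.pi_pos.le] at hu
      have hsu : Real.sin u ≠ 0 :=
        (Real.sin_pos_of_pos_of_lt_pi hu.1 (lt_of_le_of_ne hu.2 hu1)).ne'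
      have hcont : ContinuousAt (fun β => limitSpeed α β t u) 0 := by
        unfold limitSpeed
        refine ContinuousAt.div (by fun_prop) (by fun_prop) (ne_of_gt ?_)
        positivity
      have hcont' : ContinuousAt
          (fun β => 1 + limitSpeed α β t u - √(1 + limitSpeed α β t u ^ 2)) 0 := by
        fun_prop
      have := hcont'.tendsto.mono_left (nhdsWithin_le_nhds (s := Ioi 0))
      simpa [limitSpeed] using this
  have h2 := hdefect.const_sub (2 * Real.pi)
  simp only [intervalIntegral.integral_zero, sub_zero] at h2
  refine h2.congr' ?_
  filter_upwards [hpos] with β hβ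
  have h1 := continuous_limitSpeed hβ hp hq
  have h3 : IntervalIntegrable (fun u => 1 + limitSpeed α β t u) volume 0 Real.pi :=
    (continuous_const.add h1).intervalIntegrable _ _
  rw [intervalIntegral.integral_sub h3
      ((continuous_sqrt_limitSpeed hβ hp hq).intervalIntegrable _ _),
    intervalIntegral.integral_add (by simp) (h1.intervalIntegrable _ _),
    integral_limitSpeed hβ hp hq]
  simp
  ring

/-- Here the two weights agree and the phases are in quadrature, so the speed is identically 1. -/
theorem limitZeros_zero_pi_div_two : limitZeros 0 (Real.pi / 2) = √2 := by
  have h : ∀ᵐ t ∂(volume.restrict (Ioc 0 (2 * Real.pi))),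
      ∫ u in (0 : ℝ)..Real.pi, √(1 + limitSpeed 0 (Real.pi / 2) t u ^ 2) = Real.pi * √2 := by
    filter_upwards [ae_good 0] with t ht
    have hs : Real.sin (t / 2) ≠ 0 := by simpa using ht.1
    have : ∀ u, limitSpeed 0 (Real.pi / 2) t u = 1 := fun u => by
      unfold limitSpeed
      rw [add_zero, sub_zero, Real.sin_pi_div_two, Real.sin_add_pi_div_two, ← mul_add,
        Real.cos_sq_add_sin_sq, one_mul, mul_one, ← sq, abs_of_nonneg (sq_nonneg _)]
      exact div_self (pow_ne_zero 2 hs)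
    simp only [this]
    norm_num
  rw [limitZeros, intervalIntegral.integral_of_le (by positivity), integral_congr_ae h]
  have := Real.pi_pos
  simp [Real.pi_pos.le]
  field_simp

/-- Every number in `(√2, 2]` is approximated by `limitZeros α` for small `α`. -/
theorem exists_limitZeros_near {ℓ : ℝ} (h1 : √2 < ℓ) (h2 : ℓ ≤ 2) :
    ∀ᶠ α in 𝓝 (0 : ℝ), ∀ ε > 0, ∃ β, Real.sin β ≠ 0 ∧ |limitZeros α β - ℓ| ≤ ε := by
  have hβ : Real.sin (Real.pi / 2) ≠ 0 := by simp
  have hlim : Tendsto (fun α => limitZeros α (Real.pi / 2)) (𝓝 0) (𝓝 √2) := by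
    rw [← limitZeros_zero_pi_div_two]
    have hpair : Tendsto (fun α : ℝ => (α, Real.pi / 2)) (𝓝 0) (𝓝 (0, Real.pi / 2)) :=
      (by fun_prop : Continuous fun α : ℝ => (α, Real.pi / 2)).tendsto 0
    have hcont : Tendsto (fun x : ℝ × ℝ => limitZeros x.1 x.2) (𝓝 (0, Real.pi / 2))
        (𝓝 (limitZeros 0 (Real.pi / 2))) := continuousAt_limitZeros hβ
    simpa only [Function.comp_def] using hcont.comp hpair
  filter_upwards [hlim.eventually (gt_mem_nhds h1)] with α hα ε hε
  have hnear := (tendsto_limitZeros_nhdsGT_zero α).eventually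
    (lt_mem_nhds (show 2 - ε < 2 by linarith))
  obtain ⟨β₀, hβ₀, hβ₁⟩ := (hnear.and (Ioo_mem_nhdsGT Real.pi_div_two_pos)).exists
  have hsin : ∀ β ∈ Icc β₀ (Real.pi / 2), Real.sin β ≠ 0 := fun β hβ =>
    (Real.sin_pos_of_pos_of_lt_pi (hβ₁.1.trans_le hβ.1)
      (hβ.2.trans_lt (half_lt_self Real.pi_pos))).ne'
  -- If the value at β₀ is at most ℓ, it lies in (2-ε, ℓ] with ℓ ≤ 2 and is already close enough;
  -- this covers ℓ = 2, where exact attainment is not needed.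
  rcases le_total (limitZeros α β₀) ℓ with h | h
  · exact ⟨β₀, hsin _ ⟨le_rfl, hβ₁.2.le⟩, abs_le.2 ⟨by linarith, by linarith⟩⟩
  · have hcont : ContinuousOn (limitZeros α) (Icc β₀ (Real.pi / 2)) := fun β hβ =>
      ((continuousAt_limitZeros (α := α) (hsin β hβ)).comp
        (f := fun β : ℝ => (α, β)) (by fun_prop)).continuousWithinAt
    obtain ⟨β, hβ, rfl⟩ := intermediate_value_Icc' hβ₁.2.le hcont ⟨hα.le, h⟩
    exact ⟨β, hsin β hβ, by simpa using hε.le⟩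

/-! ### Irrational rotation and conclusion. -/

theorem sin_natCast_mul_ne_zero {α : ℝ} (hα : Irrational (α / (2 * Real.pi))) {n : ℕ}
    (hn : n ≠ 0) : Real.sin (n * α) ≠ 0 := by
  intro h
  obtain ⟨k, hk⟩ := Real.sin_eq_zero_iff.1 h
  refine hα ⟨(k : ℚ) / (2 * n), ?_⟩
  push_cast
  have := Real.pi_pos
  have hn' : (n : ℝ) ≠ 0 := by exact_mod_cast hn
  field_simp
  linarith

/-- If `α` is not a rational multiple of `π`, the multiples of `α` approach every angle. -/
theorem exists_tendsto_natCast_mul {α : ℝ} (hα : Irrational (α / (2 * Real.pi))) (β : ℝ) :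
    ∃ ν : ℕ → ℕ, StrictMono ν ∧ (∀ j, 1 ≤ ν j) ∧
      Tendsto (fun j => Real.cos (ν j * α)) atTop (𝓝 (Real.cos β)) ∧
      Tendsto (fun j => Real.sin (ν j * α)) atTop (𝓝 (Real.sin β)) := by
  have : Fact (0 < 2 * Real.pi) := ⟨Real.two_pi_pos⟩
  have hdense : DenseRange fun m : ℤ => m • (α : AddCircle (2 * Real.pi)) :=
    AddCircle.denseRange_zsmul_coe_iff.2 hα
  have hcluster : MapClusterPt (β : AddCircle (2 * Real.pi)) atTop
      fun n : ℕ => n • (α : AddCircle (2 * Real.pi)) := by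
    rw [mapClusterPt_atTop_nsmul_iff_mem_topologicalClosure_zmultiples]
    exact hdense β
  obtain ⟨ψ, hψ, hlim⟩ := hcluster.tendsto_subseq
  -- Dropping the first term makes every index at least 1.
  have hlim' := hlim.comp (tendsto_add_atTop_nat 1)
  refine ⟨fun j => ψ (j + 1), fun i j hij => hψ (Nat.add_lt_add_right hij 1),
    fun j => (Nat.le_add_left 1 j).trans (hψ.id_le (j + 1)), ?_, ?_⟩
  · have := (Real.Angle.continuous_cos.tendsto (β : Real.Angle)).comp hlim'
    refine this.congr fun j => ?_
    change Real.Angle.cos (ψ (j + 1) • (α : Real.Angle)) = _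
    rw [← Real.Angle.coe_nsmul, Real.Angle.cos_coe, nsmul_eq_mul]
  · have := (Real.Angle.continuous_sin.tendsto (β : Real.Angle)).comp hlim'
    refine this.congr fun j => ?_
    change Real.Angle.sin (ψ (j + 1) • (α : Real.Angle)) = _
    rw [← Real.Angle.coe_nsmul, Real.Angle.sin_coe, nsmul_eq_mul]

end RandomTrig

theorem corollary3 :
    ∀ ℓ : ℝ, √2 < ℓ → ℓ ≤ 2 → ∀ δ : ℝ, 0 < δ →
      ∃ α : ℝ, 0 ≤ α ∧ α < δ ∧
        ∀ {Ω : Type*} [MeasurableSpace Ω] (P : Measure Ω) [IsProbabilityMeasure P]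
          (a b : ℕ → Ω → ℝ), RandomTrig.IsCoefficientPair P a b α →
          ∀ ε : ℝ, 0 < ε →
            {n : ℕ | 1 ≤ n ∧ AEMeasurable (RandomTrig.zeros a b n) P ∧
              RandomTrig.expectedZeros P a b n ≠ ⊤ ∧
              |(RandomTrig.expectedZeros P a b n).toReal / n - ℓ| ≤ ε}.Infinite := by
  intro ℓ hℓ hℓ2 δ hδ
  obtain ⟨r, hr, hnear⟩ := Metric.eventually_nhds_iff.1 (RandomTrig.exists_limitZeros_near hℓ hℓ2)
  -- α = 2πx depends only on ℓ and δ; ε enters later, through the choice of β.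
  obtain ⟨x, hx, hx0, hx1⟩ := exists_irrational_btwn
    (show (0 : ℝ) < min r δ / (2 * Real.pi) by positivity)
  have hirr : Irrational (x * (2 * Real.pi) / (2 * Real.pi)) := by
    rwa [mul_div_cancel_right₀ _ Real.two_pi_pos.ne']
  have hlt : x * (2 * Real.pi) < min r δ := (lt_div_iff₀ Real.two_pi_pos).1 hx1
  have hpos : 0 < x * (2 * Real.pi) := by positivity
  refine ⟨x * (2 * Real.pi), hpos.le, hlt.trans_le (min_le_right _ _), ?_⟩
  intro Ω _ P _ a b h ε hε
  set α := x * (2 * Real.pi) with hα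
  obtain ⟨β, hβ, hclose⟩ := hnear (y := α) (by
    rw [Real.dist_eq, sub_zero, abs_of_pos hpos]
    exact hlt.trans_le (min_le_left _ _)) (ε / 2) (half_pos hε)
  obtain ⟨ν, hν, hν1, hcos, hsin⟩ := RandomTrig.exists_tendsto_natCast_mul hirr β
  have hne : ∀ j, Real.sin (ν j * α) ≠ 0 := fun j =>
    RandomTrig.sin_natCast_mul_ne_zero hirr (Nat.one_le_iff_ne_zero.1 (hν1 j))
  have hsα : Real.sin α ≠ 0 := by
    simpa using RandomTrig.sin_natCast_mul_ne_zero hirr one_ne_zero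
  have hlim := RandomTrig.tendsto_normalizedZeros hβ hν.tendsto_atTop hν1 hcos hsin hne
  obtain ⟨J, hJ⟩ := Filter.eventually_atTop.1 (Metric.tendsto_nhds.1 hlim (ε / 2) (half_pos hε))
  refine Set.infinite_of_injective_forall_mem (f := fun j => ν (J + j))
    (fun i j hij => Nat.add_left_cancel (hν.injective hij)) fun j => ?_
  obtain ⟨hmeas, hfin, hval⟩ := h.expectedZeros_div hsα (hν1 (J + j)) (hne (J + j))
  refine ⟨hν1 _, hmeas, hfin, ?_⟩
  have hd := hJ (J + j) (Nat.le_add_right _ _)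
  rw [Real.dist_eq] at hd
  rw [hval]
  calc _ ≤ _ := abs_sub_le _ (RandomTrig.limitZeros α β) _
    _ ≤ ε := by linarith
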